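/- All graphs are finite, simple and undirected. A *separation* of a graph $G=(V,E)$ is a pair $(A,B)$ of sets with $A\cup B=V$ such that $G$ has no edge between $A\setminus B$ and $B\setminus A$; its *order* is $|A\cap B|$, its *inverse* is $(B,A)$, and it is *proper* if neither $A\subseteq B$ nor $B\subseteq A$. Write $(A,B)\le(C,D)$ if $A\subseteq C$ and $B\supseteq D$. Two separations are *nested* if one is $\le$-comparable with the other or with its inverse; a set of separations is *nested* if its elements are pairwise nested. A set $P$ of separations is *consistent* if $(A,B)\in P$ and $(C,D)\le(A,B)$ imply $(D,C)\notin P$; it is a *profile* if, in addition, $(B\cap D,A\cup C)\notin P$ for all $(A,B),(C,D)\in P$; and it is a *$k$-profile* if, in addition, all its elements have order $<k$ and it contains exactly one of $(A,B),(B,A)$ for every separation $(A,B)$ of order $<k$. A *$k$-block* $b$ is a maximal set of at least $k$ vertices such that $b\subseteq A$ or $b\subseteq B$ for every separation $(A,B)$ of order $<k$; its profile is $P_k(b)=\{(A,B): |A\cap B|<k,\ b\subseteq B\}$. A *tangle of order $k$* is a set of separations of order $<k$ containing exactly one of $(A,B),(B,A)$ for every separation of order $<k$ and having no three elements $(A_i,B_i)$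 with $G[A_1]\cup G[A_2]\cup G[A_3]=G$. A separation $(A,B)$ *distinguishes* two sets $P,P'$ of separations if $(A,B)\in P\setminus P'$ and $(B,A)\in P'\setminus P$ or vice versa; it distinguishes two vertex sets if one lies in $A$, the other in $B$, and neither in $A\cap B$. A set of separations distinguishes two such objects if one of its elements does. *Strategies.* Let $S$ be a set of separations of $G$ and $\mathcal P$ a set of profiles. The *reduction* of $(S,\mathcal P)$ is $(R,\mathcal P)$, where $R$ is the set of those elements of $S$ that distinguish two elements of $\mathcal P$. Let $\mathrm{ext}(S,\mathcal P)$ be the set of all $(A,B)\in S$ with $(C,D)\le(A,B)$ or $(D,C)\le(A,B)$ for every $(C,D)\in S$, and of their inverses; let $\mathrm{loc}(S,\mathcal P)$ be the set of all separations that are $\le$-maximal in $P\cap S$ for some $P\in\mathcal P$ for which the maximal elements of $P\cap S$ are pairwise nested, and of their inverses; let $\mathrm{all}(S,\mathcal P)$ be the set of all elements of $S$ nested with every element of $S$. Let $\mathrm{ext}_r,\mathrm{loc}_r,\mathrm{all}_r$ denote the result of applying $\mathrm{ext},\mathrm{loc},\mathrm{all}$ to $(R,\mathcal P)$ instead of $(S,\mathcal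 P)$. A *strategy* is a map $\sigma:\mathbb N\to\{\mathrm{ext},\mathrm{loc},\mathrm{all},\mathrm{ext}_r,\mathrm{loc}_r,\mathrm{all}_r\}$ taking values in $\{\mathrm{ext}_r,\mathrm{loc}_r,\mathrm{all}_r\}$ infinitely often; put $\sigma^+(i)=\sigma(i+1)$. For a set $N$ of separations closed under inversion let $\mathcal O_N$ be the set of its consistent orientations (consistent subsets of $N$ containing one of $(A,B),(B,A)$ for each $(A,B)\in N$); for $O\in\mathcal O_N$ let $S_O$ be the set of all $(A,B)\in S$ for which both $O\cup\{(A,B)\}$ and $O\cup\{(B,A)\}$ are consistent, and $\mathcal P_O=\{P\in\mathcal P: P\cap N=O\}$. Call $(S,\mathcal P)$ a *feasible task* if $S$ is a set of proper separations closed under inversion, every $P\in\mathcal P$ contains one of $(A,B),(B,A)$ for each $(A,B)\in S$, every two distinct elements of $\mathcal P$ are distinguished by $S$, and whenever $(A,B),(C,D)\in S$ are not nested and $P,P'\in\mathcal P$ satisfy $(A,B),(C,D)\in P$ and $(B,A),(D,C)\in P'$, there is an $(E,F)\in P\cap S$ with $(A\cup C,B\cap D)\le(E,F)$. For feasible tasks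 define $N_\sigma(S,\mathcal P)$ recursively: it is $\emptyset$ if $S=\emptyset$; if $S\neq\emptyset$, $\sigma(0)\in\{\mathrm{ext}_r,\mathrm{loc}_r,\mathrm{all}_r\}$ and $R\subsetneq S$, it is $N_\sigma(R,\mathcal P)$; otherwise it is $N\cup\bigcup_{O\in\mathcal O_N}N_{\sigma^+}(S_O,\mathcal P_O)$ with $N=\sigma(0)(S,\mathcal P)$. For $k\ge1$, a *$k$-strategy* is a $k$-tuple $\Sigma=(\sigma_1,\dots,\sigma_k)$ of strategies with values in $\{\mathrm{ext}_r,\mathrm{loc}_r,\mathrm{all}_r\}$. For a set $\mathcal P$ of $k$-profiles define $N_\Sigma(G,\mathcal P)$ as follows. If $k=1$, it is $N_{\sigma_1}(S,\mathcal P)$, where $S$ is the set of proper separations of order $0$. If $k\ge2$, it is $N\cup\bigcup_{O\in\mathcal O_N}N_{\sigma_k}(S_O,\mathcal P_O)$, where $N=N_{(\sigma_1,\dots,\sigma_{k-1})}(G,\mathcal P_{k-1})$, $\mathcal P_{k-1}$ consists of the sets $\{(A,B)\in P:|A\cap B|<k-1\}$ with $P\in\mathcal P$, and $S$ is the set of proper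 separations of order $k-1$ that are nested with every element of $N$. *Tree-decompositions.* Every oriented edge $t_1t_2$ of the tree $T$ of a tree-decomposition $(T,\mathcal V)$ *induces* the separation $(\bigcup_{t\in T_1}V_t,\bigcup_{t\in T_2}V_t)$, where $T_i\ni t_i$ are the components of $T-t_1t_2$. The *adhesion* of $(T,\mathcal V)$ is $<k$ if $|V_t\cap V_{t'}|<k$ for all edges $tt'$ of $T$. Fix an isomorphism-invariant choice, for every graph $G$, of a set $\mathcal P(G)$ of $k$-profiles of $G$ that contains the profiles $P_k(b)$ of all $k$-blocks $b$ of $G$ and all its tangles of order $k$ (such as the set of all $k$-profiles, or the set of just these). We say that $\Sigma$ *defines* $(T,\mathcal V)$ on $G$ if mapping each oriented edge of $T$ to the separation it induces is a bijection onto $N_\Sigma(G,\mathcal P(G))$. **Theorem.** Let $k\ge1$. For every such choice of $\mathcal P$, every $k$-strategy $\Sigma$ defines on every finite graph $G$ a tree-decomposition $(T_G,\mathcal V_G)$, which is unique up to renaming the nodes of the tree. It has adhesion $<k$, and the separations it induces distinguish every two distinct $k$-blocks of $G$, every two distinct tangles of order $k$ in $G$, and every $k$-block $b$ from every tangle of order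 $k$ other than $P_k(b)$. The map $G\mapsto(T_G,\mathcal V_G)$ is canonical: for every isomorphism $\varphi:G\to G'$ there is a unique isomorphism $\psi:T_G\to T_{G'}$ that maps the part at each node $t$ to the part at $\psi(t)$, that is, the part of $G'$ at $\psi(t)$ is the $\varphi$-image of the part of $G$ at $t$. In particular, $\mathrm{Aut}(G)$ acts on $T_G$ accordingly, and a canonical map assigning to every finite graph $G$ a tree-decomposition of adhesion $<k$ that distinguishes all its $k$-blocks and tangles of order $k$ in this sense exists. -/

import Mathlib

universe u

/-- A separation `(A, B)` of the graph `G`: vertex sets with `A ∪ B = V` and no edge of `G` between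
`A \ B` and `B \ A`. -/
@[ext]
structure Separation {V : Type u} (G : SimpleGraph V) where
  left : Set V
  right : Set V
  union_eq : left ∪ right = Set.univ
  no_edge : ∀ x ∈ left \ right, ∀ y ∈ right \ left, ¬ G.Adj x y

namespace Separation

variable {V : Type u} {G : SimpleGraph V}

/-- The inverse `(B, A)` of `(A, B)`. -/
def inv (s : Separation G) : Separation G where
  left := s.right
  right := s.left
  union_eq := by rw [Set.union_comm]; exact s.union_eq
  no_edge := fun x hx y hy h => s.no_edge y hy x hx h.symm

@[simp] theorem inv_inv (s : Separation G) : s.inv.inv = s := rfl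

/-- `(A, B) ≤ (C, D)` if and only if `A ⊆ C` and `B ⊇ D`. -/
instance : PartialOrder (Separation G) where
  le s t := s.left ⊆ t.left ∧ t.right ⊆ s.right
  le_refl s := ⟨subset_rfl, subset_rfl⟩
  le_trans _ _ _ h h' := ⟨h.1.trans h'.1, h'.2.trans h.2⟩
  le_antisymm _ _ h h' := Separation.ext (h.1.antisymm h'.1) (h'.2.antisymm h.2)

/-- The order `|A ∩ B|` of `(A, B)`. -/
noncomputable def order (s : Separation G) : ℕ := (s.left ∩ s.right).ncard

/-- Neither side is contained in the other. -/
def IsProper (s : Separation G) : Prop := ¬ s.left ⊆ s.right ∧ ¬ s.right ⊆ s.left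

/-- The corner separation `(A ∪ C, B ∩ D)` of `(A, B)` and `(C, D)`. -/
def corner (s t : Separation G) : Separation G where
  left := s.left ∪ t.left
  right := s.right ∩ t.right
  union_eq := by
    ext x
    have h1 : x ∈ s.left ∪ s.right := s.union_eq ▸ Set.mem_univ x
    have h2 : x ∈ t.left ∪ t.right := t.union_eq ▸ Set.mem_univ x
    simp only [Set.mem_union, Set.mem_inter_iff, Set.mem_univ, iff_true] at *
    tauto
  no_edge := by
    intro x hx y hy h
    have h1 := s.no_edge x
    have h2 := t.no_edge x
    simp only [Set.mem_sdiff, Set.mem_union, Set.mem_inter_iff, not_or, not_and] at *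
    have h3 : x ∈ s.left ∪ s.right := s.union_eq ▸ Set.mem_univ x
    have h4 : x ∈ t.left ∪ t.right := t.union_eq ▸ Set.mem_univ x
    simp only [Set.mem_union] at h3 h4
    by_cases hs : x ∈ s.right
    · exact h2 ⟨by tauto, hx.2 hs⟩ y ⟨hy.1.2, hy.2.2⟩ h
    · exact h1 ⟨by tauto, hs⟩ y ⟨hy.1.1, hy.2.1⟩ h

/-- `s` is nested with `t` if `s` is comparable with `t` or with the inverse of `t`. -/
def Nested (s t : Separation G) : Prop := (s ≤ t ∨ t ≤ s) ∨ (s ≤ t.inv ∨ t.inv ≤ s)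

/-- `s` distinguishes two vertex sets: one lies in `A`, the other in `B`, neither in `A ∩ B`. -/
def DistinguishesSets (s : Separation G) (X Y : Set V) : Prop :=
  ((X ⊆ s.left ∧ Y ⊆ s.right) ∨ (Y ⊆ s.left ∧ X ⊆ s.right)) ∧
    ¬ X ⊆ s.left ∩ s.right ∧ ¬ Y ⊆ s.left ∩ s.right

/-- `s` distinguishes two sets of separations: one of them contains `s` but not its inverse, the
other one contains the inverse of `s` but not `s`. -/
def Distinguishes (s : Separation G) (P P' : Set (Separation G)) : Prop :=
  (s ∈ P \ P' ∧ s.inv ∈ P' \ P) ∨ (s ∈ P' \ P ∧ s.inv ∈ P \ P')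

/-- The image of a separation under a graph isomorphism. -/
def map {W : Type u} {H : SimpleGraph W} (φ : G ≃g H) (s : Separation G) : Separation H where
  left := φ '' s.left
  right := φ '' s.right
  union_eq := by
    rw [← Set.image_union, s.union_eq, Set.image_univ]
    exact φ.surjective.range_eq
  no_edge := by
    rintro _ ⟨⟨x, hx, rfl⟩, hx'⟩ _ ⟨⟨y, hy, rfl⟩, hy'⟩ h
    exact s.no_edge x ⟨hx, fun h' => hx' ⟨x, h', rfl⟩⟩ y ⟨hy, fun h' => hy' ⟨y, h', rfl⟩⟩
      (φ.map_adj_iff.1 h)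

end Separation

/-! Sets of separations, profiles, blocks and tangles. -/

section Profiles

variable {V : Type u} {G : SimpleGraph V}

/-- Every two elements are nested. -/
def IsNestedSet (S : Set (Separation G)) : Prop := ∀ s ∈ S, ∀ t ∈ S, s.Nested t

/-- `(A, B) ∈ P` and `(C, D) ≤ (A, B)` imply `(D, C) ∉ P`. -/
def IsConsistent (P : Set (Separation G)) : Prop := ∀ s ∈ P, ∀ t, t ≤ s → t.inv ∉ P

/-- A profile is a consistent set `P` of separations such that `(B ∩ D, A ∪ C) ∉ P` for all
`(A, B), (C, D) ∈ P`. -/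
def IsProfile (P : Set (Separation G)) : Prop :=
  IsConsistent P ∧ ∀ s ∈ P, ∀ t ∈ P, (s.corner t).inv ∉ P

/-- A `k`-profile is a profile all of whose elements have order `< k` and which contains exactly one
of `(A, B)` and `(B, A)` for every separation `(A, B)` of order `< k`. -/
def IsKProfile (k : ℕ) (P : Set (Separation G)) : Prop :=
  IsProfile P ∧ (∀ s ∈ P, s.order < k) ∧ ∀ s : Separation G, s.order < k → Xor (s ∈ P) (s.inv ∈ P)

/-- A set of at least `k` vertices not separated by any separation of order `< k`. -/
def IsInseparable (G : SimpleGraph V) (k : ℕ) (X : Set V) : Prop :=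
  k ≤ X.ncard ∧ ∀ s : Separation G, s.order < k → X ⊆ s.left ∨ X ⊆ s.right

/-- A `k`-block is a maximal `(< k)`-inseparable set of vertices. -/
def IsBlock (G : SimpleGraph V) (k : ℕ) (b : Set V) : Prop := Maximal (IsInseparable G k) b

/-- The set `P_k(b)` of the separations of order `< k` whose right-hand side contains `b`. -/
def blockProfile (G : SimpleGraph V) (k : ℕ) (b : Set V) : Set (Separation G) :=
  {s | s.order < k ∧ b ⊆ s.right}

/-- A tangle of order `k`: a set of separations of order `< k` that contains exactly one of `(A, B)`
and `(B, A)` for every separation of order `< k`, and such that no three of its elements satisfy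
`G[A₁] ∪ G[A₂] ∪ G[A₃] = G`. -/
def IsTangle (k : ℕ) (τ : Set (Separation G)) : Prop :=
  (∀ s ∈ τ, s.order < k) ∧
  (∀ s : Separation G, s.order < k → Xor (s ∈ τ) (s.inv ∈ τ)) ∧
  ∀ s₁ ∈ τ, ∀ s₂ ∈ τ, ∀ s₃ ∈ τ,
    (⊤ : G.Subgraph).induce s₁.left ⊔ (⊤ : G.Subgraph).induce s₂.left ⊔
      (⊤ : G.Subgraph).induce s₃.left ≠ ⊤

/-- The set of all `k`-profiles of `G`. -/
def kProfiles (G : SimpleGraph V) (k : ℕ) : Set (Set (Separation G)) := {P | IsKProfile k P}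

/-- The set of the profiles `P_k(b)` of the `k`-blocks `b` of `G`, together with the tangles of
order `k` of `G`. -/
def blocksAndTangles (G : SimpleGraph V) (k : ℕ) : Set (Set (Separation G)) :=
  {P | (∃ b, IsBlock G k b ∧ P = blockProfile G k b) ∨ IsTangle k P}

/-- A set `S` of separations distinguishes all `k`-blocks of `G` from each other (as vertex sets),
all tangles of order `k` from each other, and each `k`-block from each tangle of order `k` other than
its own profile. -/
def DistinguishesBlocksAndTangles (k : ℕ) (S : Set (Separation G)) : Prop :=
  (∀ b b', IsBlock G k b → IsBlock G k b' → b ≠ b' → ∃ s ∈ S, s.DistinguishesSets b b') ∧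
  ∀ P ∈ blocksAndTangles G k, ∀ P' ∈ blocksAndTangles G k, P ≠ P' → ∃ s ∈ S, s.Distinguishes P P'

/-- `s` splits `O` if both `O ∪ {s}` and `O ∪ {s.inv}` are consistent. -/
def Splits (s : Separation G) (O : Set (Separation G)) : Prop :=
  IsConsistent (O ∪ {s}) ∧ IsConsistent (O ∪ {s.inv})

/-- `O` is a consistent orientation of the separation system `N`. -/
def IsConsistentOrientation (N O : Set (Separation G)) : Prop :=
  O ⊆ N ∧ IsConsistent O ∧ ∀ s ∈ N, s ∈ O ∨ s.inv ∈ O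

/-- `S_O`: the separations in `S` that split `O`. -/
def splitting (S O : Set (Separation G)) : Set (Separation G) := {s ∈ S | Splits s O}

/-- `𝓟_O`: the profiles in `𝓟` that induce the orientation `O` of `N`. -/
def inducing (𝓟 : Set (Set (Separation G))) (N O : Set (Separation G)) :
    Set (Set (Separation G)) := {P ∈ 𝓟 | P ∩ N = O}

/-- The separations in `S` that distinguish some two elements of `𝓟`, that is, the set `R` such that
`(R, 𝓟)` is the reduction of `(S, 𝓟)`. -/
def reduction (S : Set (Separation G)) (𝓟 : Set (Set (Separation G))) : Set (Separation G) :=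
  {s ∈ S | ∃ P ∈ 𝓟, ∃ P' ∈ 𝓟, s.Distinguishes P P'}

/-- `s ∈ S` is extremal in `S` if every `t ∈ S` satisfies `t ≤ s` or `t.inv ≤ s`. -/
def IsExtremal (S : Set (Separation G)) (s : Separation G) : Prop :=
  s ∈ S ∧ ∀ t ∈ S, t ≤ s ∨ t.inv ≤ s

/-- `P` is well separated in `S` if the set of maximal elements of `P ∩ S` is nested. -/
def IsWellSeparated (P S : Set (Separation G)) : Prop := IsNestedSet {s | Maximal (· ∈ P ∩ S) s}

/-- `s` is locally maximal in `(S, 𝓟)` if it is maximal in `P ∩ S` for some well-separated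
`P ∈ 𝓟`. -/
def IsLocallyMaximal (S : Set (Separation G)) (𝓟 : Set (Set (Separation G)))
    (s : Separation G) : Prop :=
  ∃ P ∈ 𝓟, IsWellSeparated P S ∧ Maximal (· ∈ P ∩ S) s

end Profiles

/-! Strategies. -/

/-- The instructions `ext`, `loc`, `all`, `ext_r`, `loc_r`, `all_r`. -/
inductive Step
  | ext | loc | all | extR | locR | allR

/-- The three instructions that first reduce the task. -/
def Step.IsReducing : Step → Prop
  | .ext | .loc | .all => False
  | .extR | .locR | .allR => True

section Strategies

variable {V : Type u} {G : SimpleGraph V}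

/-- All extremal separations in `S` and their inverses. -/
def extSet (S : Set (Separation G)) : Set (Separation G) :=
  {s | IsExtremal S s ∨ IsExtremal S s.inv}

/-- All locally maximal separations in `(S, 𝓟)` and their inverses. -/
def locSet (S : Set (Separation G)) (𝓟 : Set (Set (Separation G))) : Set (Separation G) :=
  {s | IsLocallyMaximal S 𝓟 s ∨ IsLocallyMaximal S 𝓟 s.inv}

/-- All separations in `S` that are nested with every separation in `S`. -/
def allSet (S : Set (Separation G)) : Set (Separation G) := {s ∈ S | ∀ t ∈ S, s.Nested t}

/-- The separation system obtained by applying an instruction to `(S, 𝓟)`. -/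
def Step.apply : Step → Set (Separation G) → Set (Set (Separation G)) → Set (Separation G)
  | .ext, S, _ => extSet S
  | .loc, S, 𝓟 => locSet S 𝓟
  | .all, S, _ => allSet S
  | .extR, S, 𝓟 => extSet (reduction S 𝓟)
  | .locR, S, 𝓟 => locSet (reduction S 𝓟) 𝓟
  | .allR, S, 𝓟 => allSet (reduction S 𝓟)

end Strategies

/-- A strategy is a sequence of instructions infinitely many of which are reducing. -/
structure Strategy where
  step : ℕ → Step
  infinitely_often : ∀ m, ∃ n, m ≤ n ∧ (step n).IsReducing

namespace Strategy

/-- The shifted strategy `σ⁺(i) = σ(i + 1)`. -/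
def tail (σ : Strategy) : Strategy where
  step i := σ.step (i + 1)
  infinitely_often m := by
    obtain ⟨n, hn, h⟩ := σ.infinitely_often (m + 1)
    obtain ⟨n, rfl⟩ : ∃ l, n = l + 1 := ⟨n - 1, by omega⟩
    exact ⟨n, by omega, h⟩

theorem exists_isReducing (σ : Strategy) : ∃ n, (σ.step n).IsReducing :=
  let ⟨n, _, h⟩ := σ.infinitely_often 0
  ⟨n, h⟩

open Classical in
/-- The least index of a reducing instruction. -/
noncomputable def firstReducing (σ : Strategy) : ℕ := Nat.find σ.exists_isReducing

theorem firstReducing_tail_lt {σ : Strategy} (h : ¬ (σ.step 0).IsReducing) :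
    σ.tail.firstReducing < σ.firstReducing := by
  classical
  have h1 : (σ.step σ.firstReducing).IsReducing := Nat.find_spec σ.exists_isReducing
  obtain ⟨n, hn⟩ : ∃ n, σ.firstReducing = n + 1 := by
    refine ⟨σ.firstReducing - 1, ?_⟩
    have : σ.firstReducing ≠ 0 := fun h0 => h (h0 ▸ h1)
    omega
  have h2 : σ.tail.firstReducing ≤ n := Nat.find_min' _ (by rw [hn] at h1; exact h1)
  omega

end Strategy

section Determines

variable {V : Type u} {G : SimpleGraph V}

theorem splitting_subset (S O : Set (Separation G)) : splitting S O ⊆ S := fun _ h => h.1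

theorem notMem_of_splits {N O : Set (Separation G)} (hO : IsConsistentOrientation N O)
    {s : Separation G} (h : Splits s O) : s ∉ N := by
  intro hs
  rcases hO.2.2 s hs with h' | h'
  · exact h.2 s (Or.inl h') s le_rfl (Or.inr rfl)
  · exact h.1 s (Or.inr rfl) s le_rfl (Or.inl h')

theorem splitting_ncard_lt [Finite V] {S N O : Set (Separation G)}
    (hO : IsConsistentOrientation N O) (hN : (N ∩ S).Nonempty) :
    (splitting S O).ncard < S.ncard := by
  have : Finite (Separation G) :=
    Finite.of_injective (fun s : Separation G => (s.left, s.right)) fun s t h =>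
      Separation.ext (congrArg Prod.fst h) (congrArg Prod.snd h)
  obtain ⟨s, hs, hs'⟩ := hN
  exact Set.ncard_lt_ncard
    ⟨splitting_subset S O, fun h => notMem_of_splits hO (h hs').2 hs⟩ (Set.toFinite _)

theorem separation_ncard_lt [Finite V] {R S : Set (Separation G)} (h : R ⊂ S) :
    R.ncard < S.ncard := by
  have : Finite (Separation G) :=
    Finite.of_injective (fun s : Separation G => (s.left, s.right)) fun s t h =>
      Separation.ext (congrArg Prod.fst h) (congrArg Prod.snd h)
  exact Set.ncard_lt_ncard h (Set.toFinite _)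

theorem splitting_ncard_le [Finite V] (S O : Set (Separation G)) :
    (splitting S O).ncard ≤ S.ncard := by
  have : Finite (Separation G) :=
    Finite.of_injective (fun s : Separation G => (s.left, s.right)) fun s t h =>
      Separation.ext (congrArg Prod.fst h) (congrArg Prod.snd h)
  exact Set.ncard_le_ncard (splitting_subset S O) (Set.toFinite _)

open Classical in
/-- The set `N_σ(S, 𝓟)` that the strategy `σ` determines for a feasible task `(S, 𝓟)`.
If `S = ∅` it is `∅`. Otherwise put `N := σ(0)(S, 𝓟)`. If `σ(0)` is reducing and the reduction
`(R, 𝓟)` of `(S, 𝓟)` has `R ⊊ S`, then it is `N_σ(R, 𝓟)`; in all other cases it is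
`N ∪ ⋃ N_{σ⁺}(S_O, 𝓟_O)`, the union taken over all consistent orientations `O` of `N`.
(The recursion is on `|S|` and then on the least index of a reducing instruction. The set `N` is
a non-empty subset of `S` whenever `σ(0)` is reducing and `(S, 𝓟)` is a reduced feasible task with
`S ≠ ∅`; the value `∅` given to the function if it is not serves only to make it total.) -/
noncomputable def determined [Finite V] (σ : Strategy) (S : Set (Separation G))
    (𝓟 : Set (Set (Separation G))) : Set (Separation G) :=
  if S = ∅ then ∅
  else if hσ : (σ.step 0).IsReducing then
    if hR : reduction S 𝓟 ⊂ S then determined σ (reduction S 𝓟) 𝓟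
    else if hN : ((σ.step 0).apply S 𝓟 ∩ S).Nonempty then
      (σ.step 0).apply S 𝓟 ∪
        ⋃ O : {O : Set (Separation G) // IsConsistentOrientation ((σ.step 0).apply S 𝓟) O},
          determined σ.tail (splitting S O.1) (inducing 𝓟 ((σ.step 0).apply S 𝓟) O.1)
    else ∅
  else
    (σ.step 0).apply S 𝓟 ∪
      ⋃ O : {O : Set (Separation G) // IsConsistentOrientation ((σ.step 0).apply S 𝓟) O},
        determined σ.tail (splitting S O.1) (inducing 𝓟 ((σ.step 0).apply S 𝓟) O.1)
termination_by (S.ncard, σ.firstReducing)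
decreasing_by
  · exact Prod.Lex.left _ _ (separation_ncard_lt hR)
  · exact Prod.Lex.left _ _ (splitting_ncard_lt O.2 hN)
  · exact Prod.Lex.toLex_lt_toLex'.2
      ⟨splitting_ncard_le S O.1, fun _ => Strategy.firstReducing_tail_lt hσ⟩

end Determines

/-- A `k`-strategy is a `k`-tuple of strategies all of whose instructions are reducing. -/
structure KStrategy (k : ℕ) where
  strategy : Fin k → Strategy
  isReducing : ∀ i n, ((strategy i).step n).IsReducing

section KDetermines

variable {V : Type u}

/-- `P_ℓ`, the set of the elements of `P` of order `< ℓ`. -/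
def restrictOrder {G : SimpleGraph V} (ℓ : ℕ) (P : Set (Separation G)) : Set (Separation G) :=
  {s ∈ P | s.order < ℓ}

/-- The set `N_Σ(G, 𝓟)` for a `k`-tuple `Σ = (σ₁, …, σ_k)` of strategies. For `k = 1` it is
`N_{σ₁}(S, 𝓟)`, where `S` is the set of all proper separations of order `< 1`. For `k ≥ 2` it is
`N ∪ ⋃ N_{σ_k}(S_O, 𝓟_O)`, the union taken over all consistent orientations `O` of `N`, where
`N = N_{(σ₁, …, σ_{k-1})}(G, 𝓟_{k-1})` and `S` is the set of all proper separations of order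
`k - 1` that are nested with `N`. -/
noncomputable def kDetermined [Finite V] (G : SimpleGraph V) :
    (k : ℕ) → (Fin k → Strategy) → Set (Set (Separation G)) → Set (Separation G)
  | 0, _, _ => ∅
  | 1, σ, 𝓟 => determined (σ 0) {s | s.IsProper ∧ s.order < 1} 𝓟
  | k + 2, σ, 𝓟 =>
    let N := kDetermined G (k + 1) (Fin.init σ) (restrictOrder (k + 1) '' 𝓟)
    let S := {s : Separation G | s.IsProper ∧ s.order = k + 1 ∧ ∀ t ∈ N, s.Nested t}
    N ∪ ⋃ O ∈ {O | IsConsistentOrientation N O},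
      determined (σ (Fin.last (k + 1))) (splitting S O) (inducing 𝓟 N O)

end KDetermines

/-! Tree-decompositions. -/

/-- A tree-decomposition of `G` (with a finite decomposition tree). -/
structure TreeDecomposition {V : Type u} (G : SimpleGraph V) where
  Node : Type u
  finite_node : Finite Node
  tree : SimpleGraph Node
  isTree : tree.IsTree
  part : Node → Set V
  iUnion_part : ⋃ t, part t = Set.univ
  exists_part_of_adj : ∀ x y, G.Adj x y → ∃ t, x ∈ part t ∧ y ∈ part t
  inter_subset_of_mem_path : ∀ t₁ t₂ t₃ (p : tree.Walk t₁ t₃), p.IsPath → t₂ ∈ p.support →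
    part t₁ ∩ part t₃ ⊆ part t₂

namespace TreeDecomposition

variable {V : Type u} {G : SimpleGraph V}

/-- The union of the parts `V_t` over the nodes `t` in the component of `T - e` that contains `r`,
where `e` is the edge `t₁t₂`. -/
def side (D : TreeDecomposition G) (t₁ t₂ r : D.Node) : Set V :=
  ⋃ t ∈ {t | (D.tree.deleteEdges {s(t₁, t₂)}).Reachable r t}, D.part t

/-- The oriented edge `e = t₁t₂` of the decomposition tree induces the separation `s`. -/
def Induces (D : TreeDecomposition G) (e : D.tree.Dart) (s : Separation G) : Prop :=
  s.left = D.side e.fst e.snd e.fst ∧ s.right = D.side e.fst e.snd e.snd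

/-- All separations induced by the tree-decomposition. -/
def inducedSet (D : TreeDecomposition G) : Set (Separation G) := {s | ∃ e, D.Induces e s}

/-- The oriented edges of the decomposition tree correspond (via the separations they induce)
bijectively to the elements of `N`. -/
def IsInducing (D : TreeDecomposition G) (N : Set (Separation G)) : Prop :=
  (∀ e, ∃ s ∈ N, D.Induces e s) ∧ ∀ s ∈ N, ∃! e, D.Induces e s

/-- All adhesion sets have fewer than `k` elements (for `k ≥ 1`: the adhesion is `< k`). -/
def AdhesionLT (D : TreeDecomposition G) (k : ℕ) : Prop :=
  ∀ t t', D.tree.Adj t t' → (D.part t ∩ D.part t').ncard < k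

/-- `ψ` is an isomorphism between the decomposition trees that maps the parts to their images
under `φ`. -/
def IsCompatible {W : Type u} {H : SimpleGraph W} (φ : G ≃g H) (D : TreeDecomposition G)
    (D' : TreeDecomposition H) (ψ : D.tree ≃g D'.tree) : Prop :=
  ∀ t, D'.part (ψ t) = φ '' D.part t

/-- Two tree-decompositions of the same graph are the same up to renaming the nodes of the tree. -/
def IsEquivalent (D D' : TreeDecomposition G) : Prop :=
  ∃ ψ : D.tree ≃g D'.tree, ∀ t, D'.part (ψ t) = D.part t

end TreeDecomposition

/-- The `k`-strategy `Λ` defines the tree-decomposition `D` of `G`, with respect to the set `𝓟` of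
`k`-profiles: `D` is the tree-decomposition that corresponds to `N_Λ(G, 𝓟)`. -/
def KStrategy.Defines {k : ℕ} {V : Type u} [Finite V] {G : SimpleGraph V} (Λ : KStrategy k)
    (𝓟 : Set (Set (Separation G))) (D : TreeDecomposition G) : Prop :=
  D.IsInducing (kDetermined G k Λ.strategy 𝓟)

/-- An assignment of a tree-decomposition to each finite graph is canonical if it commutes with all
graph isomorphisms `φ : G → H`: there is a (unique) isomorphism between the decomposition trees of
`G` and `H` that maps every part of the first decomposition to its image under `φ` as a part of the
second. By uniqueness, these isomorphisms compose; in particular, `Aut(G)` acts on the decomposition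
tree of `G` by automorphisms. -/
def IsCanonical
    (F : (V : Type u) → [Finite V] → (G : SimpleGraph V) → TreeDecomposition G) : Prop :=
  ∀ (V W : Type u) [Finite V] [Finite W] (G : SimpleGraph V) (H : SimpleGraph W) (φ : G ≃g H),
    ∃! ψ : (F V G).tree ≃g (F W H).tree, TreeDecomposition.IsCompatible φ (F V G) (F W H) ψ

/-- An isomorphism-invariant choice, for each finite graph, of a set of `k`-profiles that includes the
profiles of all its `k`-blocks and all its tangles of order `k`. (For example, the set of all
`k`-profiles, or just the set of all `k`-block profiles and tangles of order `k`.) -/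
def IsInvariantProfileChoice (k : ℕ)
    (𝓟 : (V : Type u) → [Finite V] → (G : SimpleGraph V) → Set (Set (Separation G))) : Prop :=
  (∀ (V : Type u) [Finite V] (G : SimpleGraph V),
    blocksAndTangles G k ⊆ 𝓟 V G ∧ 𝓟 V G ⊆ kProfiles G k) ∧
  ∀ (V W : Type u) [Finite V] [Finite W] (G : SimpleGraph V) (H : SimpleGraph W) (φ : G ≃g H),
    𝓟 W H = Set.image (Separation.map φ) '' 𝓟 V G

/-! The proof has two halves: a canonical nested set of separations is built, and it is turned into
a tree.

Nested set. In a feasible task that equals its reduction, a maximal separation `s` is extremal: if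
`t` crosses `s`, some two profiles orient both `s` and `t` differently, and the corner condition
gives an element of `S` above `s` and an orientation of `t`; by maximality it is `s`
(`IsFeasible.isExtremal_of_maximal`). So `ext` is non-empty, and since `ext ⊆ loc ⊆ all` here, each
reducing instruction yields a non-empty `N` nested with all of `S`. Separations splitting different
orientations of `N` are nested (`nested_of_splits_of_ne`), and profiles agreeing on `N` meet again
in a strictly smaller subtask. Induction gives a nested set that distinguishes all profiles
(`determined_spec`).

For `k`-profiles the order is raised one step at a time, and the separations of the next order
nested with the set `N` found so far must again form feasible tasks. The invariant is efficiency: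
each element of `N` distinguishes two profiles that agree on all lower orders. With it, a separation
that distinguishes two given profiles and crosses as few elements of `N` as possible crosses none,
by submodularity (`exists_nested_distinguishing`, `isFeasible_splitting`).

Tree. The consistent orientations of a finite nested symmetric set of proper separations, adjacent
when they differ on one separation, form a tree whose edges are the separations; the part at `O` is
the intersection of the right-hand sides of its elements. Conversely, in any tree-decomposition
inducing `N`, sending a node to the orientation pointing towards it is an isomorphism onto this tree
(`TreeDecomposition.IsInducing.isEquivalent`), whence uniqueness. Canonicity follows because the
whole construction commutes with graph isomorphisms (`kDetermined_image`), and blocks and tangles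
are distinguished because they give `k`-profiles. -/

namespace Separation

/-! ### Order, inversion and nestedness of separations. -/

variable {V : Type u} {G : SimpleGraph V} {s t r : Separation G}

theorem inv_le_inv : s.inv ≤ t.inv ↔ t ≤ s := and_comm

theorem inv_le_iff : s.inv ≤ t ↔ t.inv ≤ s := ⟨fun h => inv_le_inv.1 h, fun h => inv_le_inv.1 h⟩

theorem le_inv_iff : s ≤ t.inv ↔ t ≤ s.inv := ⟨fun h => inv_le_inv.1 h, fun h => inv_le_inv.1 h⟩

theorem inv_injective : Function.Injective (inv : Separation G → Separation G) :=
  fun s t h => by rw [← inv_inv s, h, inv_inv]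

theorem inv_eq_iff : s.inv = t ↔ s = t.inv :=
  ⟨fun h => h ▸ rfl, fun h => h ▸ rfl⟩

theorem order_inv (s : Separation G) : s.inv.order = s.order :=
  congrArg Set.ncard (Set.inter_comm _ _)

theorem left_le_corner : s ≤ s.corner t := ⟨Set.subset_union_left, Set.inter_subset_left⟩

theorem right_le_corner : t ≤ s.corner t := ⟨Set.subset_union_right, Set.inter_subset_right⟩

theorem corner_le (hs : s ≤ r) (ht : t ≤ r) : s.corner t ≤ r :=
  ⟨Set.union_subset hs.1 ht.1, Set.subset_inter hs.2 ht.2⟩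

theorem IsProper.inv (h : s.IsProper) : s.inv.IsProper := ⟨h.2, h.1⟩

theorem IsProper.not_le_inv (h : s.IsProper) : ¬ s ≤ s.inv := fun h' => h.1 h'.1

theorem IsProper.not_inv_le (h : s.IsProper) : ¬ s.inv ≤ s := fun h' => h.2 h'.1

theorem IsProper.ne_inv (h : s.IsProper) : s ≠ s.inv := fun h' => h.not_le_inv h'.le

theorem isProper_of_not_le (h : ¬ s ≤ s.inv) (h' : ¬ s.inv ≤ s) : s.IsProper :=
  ⟨fun h₁ => h ⟨h₁, h₁⟩, fun h₁ => h' ⟨h₁, h₁⟩⟩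

theorem Nested.symm (h : s.Nested t) : t.Nested s := by
  rcases h with (h | h) | (h | h)
  exacts [.inl (.inr h), .inl (.inl h), .inr (.inl (le_inv_iff.1 h)), .inr (.inr (inv_le_iff.1 h))]

theorem Nested.inv_right (h : s.Nested t) : s.Nested t.inv := by
  rcases h with (h | h) | (h | h)
  exacts [.inr (.inl h), .inr (.inr h), .inl (.inl h), .inl (.inr h)]

theorem Nested.inv_left (h : s.Nested t) : s.inv.Nested t := h.symm.inv_right.symm

theorem nested_inv_right : s.Nested t.inv ↔ s.Nested t := ⟨fun h => h.inv_right, fun h => h.inv_right⟩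

theorem nested_inv_left : s.inv.Nested t ↔ s.Nested t := ⟨fun h => h.inv_left, fun h => h.inv_left⟩

theorem nested_of_le (h : s ≤ t) : s.Nested t := .inl (.inl h)

/-- A separation nested with two crossing separations is nested with their corner. -/
theorem Nested.corner (hst : ¬ s.Nested t) (hs : r.Nested s) (ht : r.Nested t) :
    r.Nested (s.corner t) := by
  -- An orientation of `r` below `s` or `t` is below the corner. Otherwise `s` and `t` lie below the
  -- same orientation of `r`, hence so does the corner, or below opposite ones, which would make
  -- them nested.
  rcases hs with (hs | hs) | (hs | hs)
  · exact .inl (.inl (hs.trans left_le_corner))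
  · rcases ht with (ht | ht) | (ht | ht)
    · exact .inl (.inl (ht.trans right_le_corner))
    · exact .inl (.inr (corner_le hs ht))
    · exact absurd (.inr (.inl (hs.trans ht))) hst
    · exact (nested_of_le ((inv_le_iff.1 ht).trans right_le_corner)).inv_left
  · rcases ht with (ht | ht) | (ht | ht)
    · exact .inl (.inl (ht.trans right_le_corner))
    · exact absurd (.inr (.inl ((le_inv_iff.1 hs).trans (inv_le_inv.2 ht)))) hst
    · exact (corner_le (le_inv_iff.1 hs) (le_inv_iff.1 ht) |> nested_of_le).symm.inv_left
    · exact (nested_of_le ((inv_le_iff.1 ht).trans right_le_corner)).inv_left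
  · exact (nested_of_le ((inv_le_iff.1 hs).trans left_le_corner)).inv_left

theorem finite [Finite V] : Finite (Separation G) :=
  Finite.of_injective (fun s : Separation G => (s.left, s.right)) fun _ _ h =>
    Separation.ext (congrArg Prod.fst h) (congrArg Prod.snd h)

end Separation

/-! ### Feasible tasks and the effect of a single instruction. -/

section Tasks

open Separation

variable {V : Type u} {G : SimpleGraph V} {S N O P P' : Set (Separation G)}
  {𝓟 : Set (Set (Separation G))} {s t : Separation G}

theorem IsConsistent.not_inv_le (h : IsConsistent P) (hs : s ∈ P) (ht : t ∈ P) : ¬ t.inv ≤ s :=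
  fun h' => h s hs t.inv h' ht

theorem IsConsistent.inv_notMem (h : IsConsistent P) (hs : s ∈ P) : s.inv ∉ P :=
  h s hs s le_rfl

theorem isConsistent_iff : IsConsistent P ↔ ∀ s ∈ P, ∀ t ∈ P, ¬ t.inv ≤ s :=
  ⟨fun h _ hs _ ht => h.not_inv_le hs ht, fun h s hs t hts ht => h s hs t.inv ht hts⟩

theorem IsConsistent.mono (h : IsConsistent P) (h' : P' ⊆ P) : IsConsistent P' :=
  fun s hs t hts ht => h s (h' hs) t hts (h' ht)

theorem isConsistent_insert_iff (hO : IsConsistent O) :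
    IsConsistent (O ∪ {s}) ↔ ¬ s.inv ≤ s ∧ ∀ t ∈ O, ¬ s.inv ≤ t := by
  simp only [isConsistent_iff] at hO ⊢
  constructor
  · exact fun h => ⟨h s (.inr rfl) s (.inr rfl), fun t ht => h t (.inl ht) s (.inr rfl)⟩
  · rintro ⟨h1, h2⟩ x (hx | rfl) y (hy | rfl)
    exacts [hO x hx y hy, h2 x hx, fun h => h2 y hy (inv_le_iff.1 h), h1]

theorem splits_iff (hO : IsConsistent O) (hs : s.IsProper) :
    Splits s O ↔ ∀ t ∈ O, ¬ s ≤ t ∧ ¬ s.inv ≤ t := by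
  rw [Splits, isConsistent_insert_iff hO, isConsistent_insert_iff hO]
  simp only [inv_inv]
  exact ⟨fun h t ht => ⟨h.2.2 t ht, h.1.2 t ht⟩,
    fun h => ⟨⟨hs.not_inv_le, fun t ht => (h t ht).2⟩, ⟨hs.not_le_inv, fun t ht => (h t ht).1⟩⟩⟩

theorem Splits.inv (h : Splits s O) : Splits s.inv O := ⟨h.2, h.1⟩

/-- A separation that two consistent extensions of `O` orient differently splits `O`. -/
theorem splits_of_mem (hP : IsConsistent P) (hP' : IsConsistent P') (hO : O ⊆ P) (hO' : O ⊆ P')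
    (hs : s ∈ P) (hs' : s.inv ∈ P') : Splits s O :=
  ⟨hP.mono (Set.union_subset hO (Set.singleton_subset_iff.2 hs)),
    hP'.mono (Set.union_subset hO' (Set.singleton_subset_iff.2 hs'))⟩

theorem isProper_of_mem (hP : IsConsistent P) (hP' : IsConsistent P') (hs : s ∈ P)
    (hs' : s.inv ∈ P') : s.IsProper :=
  isProper_of_not_le (fun h => hP'.not_inv_le hs' hs' h) (hP.not_inv_le hs hs)

/-- A consistent set never contains both a separation and its inverse, so the exclusions in
`Distinguishes` are automatic. -/
theorem distinguishes_iff (hP : IsConsistent P) (hP' : IsConsistent P') :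
    s.Distinguishes P P' ↔ (s ∈ P ∧ s.inv ∈ P') ∨ (s ∈ P' ∧ s.inv ∈ P) := by
  constructor
  · rintro (h | h)
    exacts [.inl ⟨h.1.1, h.2.1⟩, .inr ⟨h.1.1, h.2.1⟩]
  · rintro (⟨h, h'⟩ | ⟨h, h'⟩)
    · exact .inl ⟨⟨h, fun h1 => hP'.inv_notMem h1 h'⟩, h', hP.inv_notMem h⟩
    · exact .inr ⟨⟨h, fun h1 => hP.inv_notMem h1 h'⟩, h', hP'.inv_notMem h⟩

/-- A feasible task. -/
structure IsFeasible (S : Set (Separation G)) (𝓟 : Set (Set (Separation G))) : Prop where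
  proper : ∀ s ∈ S, s.IsProper
  inv_mem : ∀ s ∈ S, s.inv ∈ S
  consistent : ∀ P ∈ 𝓟, IsConsistent P
  orients : ∀ P ∈ 𝓟, ∀ s ∈ S, s ∈ P ∨ s.inv ∈ P
  distinguished : ∀ P ∈ 𝓟, ∀ P' ∈ 𝓟, P ≠ P' → ∃ s ∈ S, s ∈ P ∧ s.inv ∈ P'
  corner : ∀ s ∈ S, ∀ t ∈ S, ¬ s.Nested t → ∀ P ∈ 𝓟, ∀ P' ∈ 𝓟, s ∈ P → t ∈ P → s.inv ∈ P' →
    t.inv ∈ P' → ∃ e ∈ P ∩ S, s.corner t ≤ e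

theorem mem_reduction_iff (hP : ∀ P ∈ 𝓟, IsConsistent P) :
    s ∈ reduction S 𝓟 ↔ s ∈ S ∧ ∃ P ∈ 𝓟, ∃ P' ∈ 𝓟, s ∈ P ∧ s.inv ∈ P' := by
  refine and_congr_right fun _ => ⟨?_, ?_⟩
  · rintro ⟨P, h, P', h', hd⟩
    rcases (distinguishes_iff (hP P h) (hP P' h')).1 hd with hd | hd
    exacts [⟨P, h, P', h', hd⟩, ⟨P', h', P, h, hd⟩]
  · rintro ⟨P, h, P', h', hd⟩
    exact ⟨P, h, P', h', (distinguishes_iff (hP P h) (hP P' h')).2 (.inl hd)⟩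

theorem reduction_subset : reduction S 𝓟 ⊆ S := fun _ h => h.1

namespace IsFeasible

theorem reduction (h : IsFeasible S 𝓟) : IsFeasible (reduction S 𝓟) 𝓟 where
  proper s hs := h.proper s hs.1
  inv_mem s hs := by
    rw [mem_reduction_iff h.consistent] at hs ⊢
    obtain ⟨hs, P, hP, P', hP', h1, h2⟩ := hs
    exact ⟨h.inv_mem s hs, P', hP', P, hP, h2, h1⟩
  consistent := h.consistent
  orients P hP s hs := h.orients P hP s hs.1
  distinguished P hP P' hP' hne := by
    obtain ⟨s, hs, h1, h2⟩ := h.distinguished P hP P' hP' hne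
    exact ⟨s, (mem_reduction_iff h.consistent).2 ⟨hs, P, hP, P', hP', h1, h2⟩, h1, h2⟩
  corner s hs t ht hst P hP P' hP' h1 h2 h3 h4 := by
    obtain ⟨e, ⟨heP, heS⟩, he⟩ := h.corner s hs.1 t ht.1 hst P hP P' hP' h1 h2 h3 h4
    refine ⟨e, ⟨heP, (mem_reduction_iff h.consistent).2 ⟨heS, P, hP, P', hP', heP, ?_⟩⟩, he⟩
    -- `e` lies above `s`, so `P'`, which contains `s.inv`, must contain `e.inv`: thus `e`
    -- distinguishes `P` from `P'` and survives the reduction.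
    exact (h.orients P' hP' e heS).resolve_left fun h5 =>
      (h.consistent P' hP').not_inv_le h5 h3 (left_le_corner.trans he)

/-- Passing to the subtask at an orientation `O`. -/
theorem splitting (h : IsFeasible S 𝓟) (N O : Set (Separation G)) :
    IsFeasible (splitting S O) (inducing 𝓟 N O) where
  proper s hs := h.proper s hs.1
  inv_mem s hs := ⟨h.inv_mem s hs.1, hs.2.inv⟩
  consistent P hP := h.consistent P hP.1
  orients P hP s hs := h.orients P hP.1 s hs.1
  distinguished P hP P' hP' hne := by
    obtain ⟨s, hs, h1, h2⟩ := h.distinguished P hP.1 P' hP'.1 hne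
    exact ⟨s, ⟨hs, splits_of_mem (h.consistent P hP.1) (h.consistent P' hP'.1)
      (hP.2 ▸ Set.inter_subset_left) (hP'.2 ▸ Set.inter_subset_left) h1 h2⟩, h1, h2⟩
  corner s hs t ht hst P hP P' hP' h1 h2 h3 h4 := by
    obtain ⟨e, ⟨heP, heS⟩, he⟩ := h.corner s hs.1 t ht.1 hst P hP.1 P' hP'.1 h1 h2 h3 h4
    refine ⟨e, ⟨heP, heS, splits_of_mem (h.consistent P hP.1) (h.consistent P' hP'.1)
      (hP.2 ▸ Set.inter_subset_left) (hP'.2 ▸ Set.inter_subset_left) heP ?_⟩, he⟩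
    exact (h.orients P' hP'.1 e heS).resolve_left fun h5 =>
      (h.consistent P' hP'.1).not_inv_le h5 h3 (left_le_corner.trans he)

/-- In a reduced feasible task every maximal separation is extremal. -/
theorem isExtremal_of_maximal (h : IsFeasible S 𝓟) (hR : S ⊆ _root_.reduction S 𝓟)
    (hs : Maximal (· ∈ S) s) : IsExtremal S s := by
  refine ⟨hs.1, fun t ht => ?_⟩
  by_cases hst : s.Nested t
  · rcases hst with (h1 | h1) | (h1 | h1)
    · exact .inl (hs.2 ht h1)
    · exact .inl h1
    · exact .inr (hs.2 (h.inv_mem t ht) h1)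
    · exact .inr h1
  have key : ∀ t ∈ S, ¬ s.Nested t → (∃ P ∈ 𝓟, ∃ P' ∈ 𝓟, s ∈ P ∧ t ∈ P ∧ s.inv ∈ P' ∧ t.inv ∈ P') →
      t ≤ s := by
    rintro t ht hst ⟨P, hP, P', hP', h1, h2, h3, h4⟩
    obtain ⟨e, ⟨_, heS⟩, he⟩ := h.corner s hs.1 t ht hst P hP P' hP' h1 h2 h3 h4
    exact (right_le_corner.trans he).trans (hs.2 heS (left_le_corner.trans he))
  suffices ∃ t' ∈ S, (t' = t ∨ t' = t.inv) ∧
      ∃ P ∈ 𝓟, ∃ P' ∈ 𝓟, s ∈ P ∧ t' ∈ P ∧ s.inv ∈ P' ∧ t'.inv ∈ P' by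
    obtain ⟨t', ht', rfl | rfl, h1⟩ := this
    · exact .inl (key _ ht' hst h1)
    · exact .inr (key _ ht' (fun h2 => hst (nested_inv_right.1 h2)) h1)
  -- `P, P'` differ on `s` and `Q, Q'` differ on `t`. Some two of these four profiles differ on
  -- both.
  obtain ⟨-, P, hP, P', hP', h1, h2⟩ := (mem_reduction_iff h.consistent).1 (hR hs.1)
  obtain ⟨-, Q, hQ, Q', hQ', h3, h4⟩ := (mem_reduction_iff h.consistent).1 (hR ht)
  have hti := h.inv_mem t ht
  rcases h.orients P hP t ht with h5 | h5 <;> rcases h.orients P' hP' t ht with h6 | h6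
  · rcases h.orients Q' hQ' s hs.1 with h7 | h7
    · exact ⟨_, hti, .inr rfl, Q', hQ', P', hP', h7, h4, h2, h6⟩
    · exact ⟨_, ht, .inl rfl, P, hP, Q', hQ', h1, h5, h7, h4⟩
  · exact ⟨_, ht, .inl rfl, P, hP, P', hP', h1, h5, h2, h6⟩
  · exact ⟨_, hti, .inr rfl, P, hP, P', hP', h1, h5, h2, h6⟩
  · rcases h.orients Q hQ s hs.1 with h7 | h7
    · exact ⟨_, ht, .inl rfl, Q, hQ, P', hP', h7, h3, h2, h6⟩
    · exact ⟨_, hti, .inr rfl, P, hP, Q, hQ, h1, h5, h7, h3⟩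

end IsFeasible

/-- Up to inversion `t` lies in `P`, hence below a maximal `m` of `P ∩ S`, and `m` is nested with
`s` as `P` is well separated. Consistency rules out `m.inv ≤ s`; each remaining relation passes down
from `m` to `t`. -/
theorem IsLocallyMaximal.nested [Finite V] (h : IsFeasible S 𝓟) (hs : IsLocallyMaximal S 𝓟 s)
    (ht : t ∈ S) : s.Nested t := by
  have := Separation.finite (G := G)
  obtain ⟨P, hP, hw, hmax⟩ := hs
  have key : ∀ t ∈ S, t ∈ P → s.Nested t := by
    intro t ht htP
    obtain ⟨m, htm, hm⟩ := (Set.toFinite (P ∩ S)).exists_le_maximal ⟨htP, ht⟩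
    rcases hw s hmax m hm with (h1 | h1) | (h1 | h1)
    · exact .inl (.inr (htm.trans (hmax.2 hm.1 h1)))
    · exact .inl (.inr (htm.trans h1))
    · exact .inr (.inl (h1.trans (inv_le_inv.2 htm)))
    · exact absurd h1 ((h.consistent P hP).not_inv_le hmax.1.1 hm.1.1)
  rcases h.orients P hP t ht with h1 | h1
  · exact key t ht h1
  · exact nested_inv_right.1 (key _ (h.inv_mem t ht) h1)

theorem locSet_subset_allSet [Finite V] (h : IsFeasible S 𝓟) : locSet S 𝓟 ⊆ allSet S := by
  rintro s (hs | hs)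
  · exact ⟨hs.choose_spec.2.2.1.2, fun t ht => hs.nested h ht⟩
  · exact ⟨h.inv_mem _ hs.choose_spec.2.2.1.2, fun t ht => nested_inv_left.1 (hs.nested h ht)⟩

/-- An extremal separation is the greatest element of `P ∩ S` for every `P ∈ 𝓟` containing it, so
such a `P` is trivially well separated. Reducedness provides such a `P`. -/
theorem extSet_subset_locSet (h : IsFeasible S 𝓟) (hR : S ⊆ reduction S 𝓟) :
    extSet S ⊆ locSet S 𝓟 := by
  have key : ∀ s, IsExtremal S s → IsLocallyMaximal S 𝓟 s := by
    intro s hs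
    obtain ⟨-, P, hP, -, -, h1, -⟩ := (mem_reduction_iff h.consistent).1 (hR hs.1)
    have hle : ∀ t ∈ P ∩ S, t ≤ s := fun t ht =>
      (hs.2 t ht.2).resolve_right ((h.consistent P hP).not_inv_le h1 ht.1)
    have hm : Maximal (· ∈ P ∩ S) s := ⟨⟨h1, hs.1⟩, fun t ht _ => hle t ht⟩
    refine ⟨P, hP, fun t ht r hr => ?_, hm⟩
    exact .inl (.inl ((hle t ht.1).trans (hr.2 hm.1 (hle r hr.1))))
  rintro s (hs | hs)
  exacts [.inl (key s hs), .inr (key _ hs)]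

theorem extSet_nonempty [Finite V] (h : IsFeasible S 𝓟) (hR : S ⊆ reduction S 𝓟)
    (hS : S.Nonempty) : (extSet S).Nonempty := by
  have := Separation.finite (G := G)
  obtain ⟨s, hs⟩ := hS
  obtain ⟨m, -, hm⟩ := (Set.toFinite S).exists_le_maximal hs
  exact ⟨m, .inl (h.isExtremal_of_maximal hR hm)⟩

theorem extSet_inv (hs : s ∈ extSet S) : s.inv ∈ extSet S := hs.symm

theorem locSet_inv (hs : s ∈ locSet S 𝓟) : s.inv ∈ locSet S 𝓟 := hs.symm

theorem allSet_inv (hS : ∀ s ∈ S, s.inv ∈ S) (hs : s ∈ allSet S) : s.inv ∈ allSet S :=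
  ⟨hS s hs.1, fun t ht => (hs.2 t ht).inv_left⟩

/-- A reducing instruction yields a non-empty symmetric set of separations nested with the whole
of a reduced feasible task. -/
theorem Step.apply_of_isReducing [Finite V] {a : Step} (ha : a.IsReducing) (h : IsFeasible S 𝓟)
    (hR : reduction S 𝓟 = S) (hS : S.Nonempty) :
    a.apply S 𝓟 ⊆ allSet S ∧ (a.apply S 𝓟).Nonempty ∧ ∀ s ∈ a.apply S 𝓟, s.inv ∈ a.apply S 𝓟 := by
  have h1 := extSet_nonempty h hR.ge hS
  have h2 := extSet_subset_locSet h hR.ge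
  have h3 := locSet_subset_allSet h
  cases a
  · exact ha.elim
  · exact ha.elim
  · exact ha.elim
  · simp only [Step.apply, hR]
    exact ⟨h2.trans h3, h1, fun _ => extSet_inv⟩
  · simp only [Step.apply, hR]
    exact ⟨h3, h1.mono h2, fun _ => locSet_inv⟩
  · simp only [Step.apply, hR]
    exact ⟨subset_rfl, h1.mono (h2.trans h3), fun _ => allSet_inv h.inv_mem⟩

/-- Separations that split different consistent orientations of `N` and are nested with `N` are
nested with each other. -/
theorem nested_of_splits_of_ne {O' : Set (Separation G)} (hO : IsConsistentOrientation N O)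
    (hO' : IsConsistentOrientation N O') (hne : O ≠ O') (hs : Splits s O) (ht : Splits t O')
    (hsN : ∀ n ∈ N, s.Nested n) (htN : ∀ n ∈ N, t.Nested n) : s.Nested t := by
  -- Since `s` splits `O`, no element of `O` lies above `s` or `s.inv`; an element nested with `s`
  -- must therefore lie below one of them.
  have key : ∀ {O : Set (Separation G)} {s n : Separation G}, Splits s O → n ∈ O → s.Nested n → n ≤ s ∨ n ≤ s.inv := by
    intro O s n hs hn h
    rcases h with (h | h) | (h | h)
    · exact absurd h (hs.2.not_inv_le (.inl hn) (.inr rfl))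
    · exact .inl h
    · exact .inr (le_inv_iff.1 h)
    · exact absurd (inv_le_iff.1 h) (hs.1.not_inv_le (.inl hn) (.inr rfl))
  -- An `n` on which the two orientations differ separates `s` from `t`.
  obtain ⟨n, hn, hn'⟩ : ∃ n ∈ O, n.inv ∈ O' := by
    by_contra! hc
    have hsub : O ⊆ O' := fun n hn => (hO'.2.2 n (hO.1 hn)).resolve_right (hc n hn)
    refine hne (hsub.antisymm fun n hn => (hO.2.2 n (hO'.1 hn)).resolve_right fun h => ?_)
    exact hO'.2.1.inv_notMem hn (hsub h)
  have h1 := key hs hn (hsN n (hO.1 hn))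
  have h2 := key ht hn' (nested_inv_right.2 (htN n (hO.1 hn)))
  rcases h1 with h1 | h1 <;> rcases h2 with h2 | h2
  · exact .inr (.inr ((inv_le_iff.1 h2).trans h1))
  · exact .inl (.inr ((inv_le_inv.1 h2).trans h1))
  · exact .inl (.inl ((le_inv_iff.1 h1).trans h2))
  · exact .inr (.inl ((le_inv_iff.1 h1).trans h2))

end Tasks

/-! ### Combining solutions of subtasks. -/

section Resolving

open Separation

variable {V : Type u} {G : SimpleGraph V} {S N M P : Set (Separation G)}
  {𝓟 : Set (Set (Separation G))} {s t : Separation G}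

/-- `M` is a symmetric nested set that distinguishes every two elements of `𝓟`. -/
structure IsResolving (M : Set (Separation G)) (𝓟 : Set (Set (Separation G))) : Prop where
  inv_mem : ∀ s ∈ M, s.inv ∈ M
  nested : IsNestedSet M
  distinguished : ∀ P ∈ 𝓟, ∀ P' ∈ 𝓟, P ≠ P' → ∃ s ∈ M, s ∈ P ∧ s.inv ∈ P'

theorem isConsistentOrientation_inter (hP : IsConsistent P) (h : ∀ n ∈ N, n ∈ P ∨ n.inv ∈ P)
    (hN : ∀ n ∈ N, n.inv ∈ N) : IsConsistentOrientation N (P ∩ N) :=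
  ⟨Set.inter_subset_right, hP.mono Set.inter_subset_left,
    fun n hn => (h n hn).imp (fun h' => ⟨h', hn⟩) fun h' => ⟨h', hN n hn⟩⟩

/-- Resolving sets for the subtasks at the consistent orientations of `N` combine with `N` to a
resolving set. -/
theorem IsResolving.amalgamate {D : Set (Separation G) → Set (Separation G)}
    (hNi : ∀ n ∈ N, n.inv ∈ N) (hN : IsNestedSet N) (hS : ∀ s ∈ S, ∀ n ∈ N, s.Nested n)
    (hP : ∀ P ∈ 𝓟, IsConsistent P) (hPN : ∀ P ∈ 𝓟, ∀ n ∈ N, n ∈ P ∨ n.inv ∈ P)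
    (hDS : ∀ O, IsConsistentOrientation N O → D O ⊆ splitting S O)
    (hD : ∀ O, IsConsistentOrientation N O → IsResolving (D O) (inducing 𝓟 N O))
    (hM : ∀ s, s ∈ M ↔ s ∈ N ∨ ∃ O, IsConsistentOrientation N O ∧ s ∈ D O) :
    IsResolving M 𝓟 where
  inv_mem s hs := by
    rw [hM] at hs ⊢
    exact hs.imp (hNi s) fun ⟨O, hO, h⟩ => ⟨O, hO, (hD O hO).inv_mem s h⟩
  nested s hs t ht := by
    rw [hM] at hs ht
    rcases hs with hs | ⟨O, hO, hs⟩ <;> rcases ht with ht | ⟨O', hO', ht⟩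
    · exact hN s hs t ht
    · exact (hS t (hDS O' hO' ht).1 s hs).symm
    · exact hS s (hDS O hO hs).1 t ht
    · by_cases h : O = O'
      · subst h
        exact (hD O hO).nested s hs t ht
      · exact nested_of_splits_of_ne hO hO' h (hDS O hO hs).2 (hDS O' hO' ht).2
          (hS s (hDS O hO hs).1) (hS t (hDS O' hO' ht).1)
  distinguished P h P' h' hne := by
    have hO := isConsistentOrientation_inter (hP P h) (hPN P h) hNi
    -- Profiles inducing the same orientation of `N` are distinguished inside their common subtask;
    -- all others already by `N`.
    by_cases heq : P' ∩ N = P ∩ N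
    · obtain ⟨s, hs, hs'⟩ := (hD _ hO).distinguished P ⟨h, rfl⟩ P' ⟨h', heq⟩ hne
      exact ⟨s, (hM s).2 (.inr ⟨_, hO, hs⟩), hs'⟩
    · by_contra! hc
      have hsub : P ∩ N ⊆ P' ∩ N := fun n hn =>
        ⟨(hPN P' h' n hn.2).resolve_right (hc n ((hM n).2 (.inl hn.2)) hn.1), hn.2⟩
      refine heq (Set.Subset.antisymm (fun n hn => ⟨(hPN P h n hn.2).resolve_right fun h1 => ?_, hn.2⟩)
        hsub)
      exact (hP P' h').inv_notMem hn.1 (hsub ⟨h1, hNi n hn.2⟩).1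

end Resolving

/-! ### The recursion of a single strategy. -/

section Determined

open Separation

variable {V : Type u} [Finite V] {G : SimpleGraph V} {S : Set (Separation G)}
  {𝓟 : Set (Set (Separation G))}

theorem determined_empty (σ : Strategy) : determined σ (∅ : Set (Separation G)) 𝓟 = ∅ := by
  rw [determined, if_pos rfl]

theorem determined_of_reduction_ssubset {σ : Strategy} (hσ : (σ.step 0).IsReducing)
    (hR : reduction S 𝓟 ⊂ S) : determined σ S 𝓟 = determined σ (reduction S 𝓟) 𝓟 := by
  rw [determined, if_neg, dif_pos hσ, dif_pos hR]
  rintro rfl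
  exact (Set.ssubset_iff_subset_ne.1 hR).2 (Set.subset_empty_iff.1 hR.1)

theorem determined_of_reduction_eq {σ : Strategy} (hσ : (σ.step 0).IsReducing)
    (hR : reduction S 𝓟 = S) (hN : ((σ.step 0).apply S 𝓟 ∩ S).Nonempty) :
    determined σ S 𝓟 = (σ.step 0).apply S 𝓟 ∪
      ⋃ O ∈ {O | IsConsistentOrientation ((σ.step 0).apply S 𝓟) O},
        determined σ.tail (splitting S O) (inducing 𝓟 ((σ.step 0).apply S 𝓟) O) := by
  rw [determined, if_neg, dif_pos hσ, dif_neg (fun h => h.ne hR), dif_pos hN, Set.biUnion_eq_iUnion]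
  · rfl
  · rintro rfl
    simp at hN

/-- Covers the empty task and the default value in the definition; needed because `determined_image`
does not assume feasibility. -/
theorem determined_of_not_nonempty {σ : Strategy} (hσ : (σ.step 0).IsReducing)
    (hR : reduction S 𝓟 = S) (hN : ¬ ((σ.step 0).apply S 𝓟 ∩ S).Nonempty) :
    determined σ S 𝓟 = ∅ := by
  rw [determined]
  split_ifs with h1
  · rfl
  · exact absurd hR (‹reduction S 𝓟 ⊂ S›).ne
  · rfl

/-- The set that a strategy with reducing instructions determines for a feasible task. -/
theorem determined_spec {σ : Strategy} (hσ : ∀ n, (σ.step n).IsReducing) (h : IsFeasible S 𝓟) :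
    determined σ S 𝓟 ⊆ reduction S 𝓟 ∧ IsResolving (determined σ S 𝓟) 𝓟 := by
  induction hn : S.ncard using Nat.strong_induction_on generalizing S 𝓟 σ with
  | _ n ih =>
    subst hn
    rcases S.eq_empty_or_nonempty with rfl | hS
    · rw [determined_empty]
      refine ⟨Set.empty_subset _, ?_, ?_, fun P hP P' hP' hne => ?_⟩
      · simp
      · simp [IsNestedSet]
      -- With `S = ∅`, feasibility leaves no two distinct profiles.
      · simpa using h.distinguished P hP P' hP' hne
    by_cases hR : reduction S 𝓟 = S
    · obtain ⟨h1, h2, h3⟩ := Step.apply_of_isReducing (hσ 0) h hR hS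
      have h1' := h1.trans (fun s hs => hs.1 : allSet S ⊆ S)
      have hN : ((σ.step 0).apply S 𝓟 ∩ S).Nonempty := by
        rwa [Set.inter_eq_left.2 h1']
      rw [determined_of_reduction_eq (hσ 0) hR hN]
      set N := (σ.step 0).apply S 𝓟
      -- Elements of `N` split no orientation of `N`, so each subtask has lost at least one
      -- separation.
      have ih' : ∀ O, IsConsistentOrientation N O → _ := fun O hO =>
        ih _ (splitting_ncard_lt hO hN) (σ := σ.tail) (fun n => hσ (n + 1)) (h.splitting N O) rfl
      have hD : ∀ O, IsConsistentOrientation N O → determined σ.tail (splitting S O)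
          (inducing 𝓟 N O) ⊆ splitting S O := fun O hO => (ih' O hO).1.trans reduction_subset
      refine ⟨?_, IsResolving.amalgamate (S := S)
        (D := fun O => determined σ.tail (splitting S O) (inducing 𝓟 N O)) h3 ?_ ?_ h.consistent ?_
        hD (fun O hO => (ih' O hO).2) (by simp)⟩
      · rw [hR]
        exact Set.union_subset h1' (Set.iUnion₂_subset fun O hO =>
          (hD O hO).trans (splitting_subset S O))
      · exact fun s hs t ht => (h1 hs).2 t (h1' ht)
      · exact fun s hs t ht => ((h1 ht).2 s hs).symm
      · exact fun P hP n hn => h.orients P hP n (h1' hn)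
    · have hR' : reduction S 𝓟 ⊂ S := Set.ssubset_iff_subset_ne.2 ⟨reduction_subset, hR⟩
      rw [determined_of_reduction_ssubset (hσ 0) hR']
      have := ih _ (separation_ncard_lt hR') hσ h.reduction rfl
      exact ⟨this.1.trans reduction_subset, this.2⟩

end Determined

/-! ### `k`-profiles and the recursion on the order. -/

section KProfiles

open Separation

variable {V : Type u} {G : SimpleGraph V} {k ℓ : ℕ} {P : Set (Separation G)} {s t : Separation G}

namespace IsKProfile

theorem consistent (h : IsKProfile k P) : IsConsistent P := h.1.1

theorem mem_or (h : IsKProfile k P) (hs : s.order < k) : s ∈ P ∨ s.inv ∈ P := (h.2.2 s hs).or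

theorem corner_mem (h : IsKProfile k P) (hs : s ∈ P) (ht : t ∈ P) (hst : (s.corner t).order < k) :
    s.corner t ∈ P := (h.mem_or hst).resolve_right (h.1.2 s hs t ht)

theorem inv_mem_of_le (h : IsKProfile k P) (hs : s.inv ∈ P) (hst : s ≤ t) (ht : t.order < k) :
    t.inv ∈ P := (h.mem_or ht).resolve_left fun h' => h.consistent.not_inv_le h' hs hst

theorem restrictOrder (h : IsKProfile k P) (hℓ : ℓ ≤ k) : IsKProfile ℓ (restrictOrder ℓ P) := by
  refine ⟨⟨h.consistent.mono fun s hs => hs.1, fun s hs t ht h' => h.1.2 s hs.1 t ht.1 h'.1⟩,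
    fun s hs => hs.2, fun s hs => ?_⟩
  have := h.2.2 s (hs.trans_le hℓ)
  simpa [_root_.restrictOrder, hs, order_inv] using this

end IsKProfile

/-- The separators of two opposite corners have the same union and the same intersection as those of
`s` and `t`. This is submodularity, here with equality. -/
theorem order_corner_add [Finite V] (s t : Separation G) :
    (s.corner t).order + (s.inv.corner t.inv).order = s.order + t.order := by
  have h1 := Set.ncard_union_add_ncard_inter (s.left ∩ s.right) (t.left ∩ t.right)
  have h2 := Set.ncard_union_add_ncard_inter ((s.left ∪ t.left) ∩ (s.right ∩ t.right))
    ((s.right ∪ t.right) ∩ (s.left ∩ t.left))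
  have hs : ∀ x, x ∈ s.left ∨ x ∈ s.right := fun x => by
    have : x ∈ s.left ∪ s.right := s.union_eq ▸ Set.mem_univ x
    exact this
  have ht : ∀ x, x ∈ t.left ∨ x ∈ t.right := fun x => by
    have : x ∈ t.left ∪ t.right := t.union_eq ▸ Set.mem_univ x
    exact this
  have e1 : (s.left ∪ t.left) ∩ (s.right ∩ t.right) ∪ (s.right ∪ t.right) ∩ (s.left ∩ t.left) =
      s.left ∩ s.right ∪ t.left ∩ t.right := by
    ext x
    have := hs x
    have := ht x
    simp only [Set.mem_union, Set.mem_inter_iff]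
    tauto
  have e2 : (s.left ∪ t.left) ∩ (s.right ∩ t.right) ∩ ((s.right ∪ t.right) ∩ (s.left ∩ t.left)) =
      s.left ∩ s.right ∩ (t.left ∩ t.right) := by
    ext x
    simp only [Set.mem_union, Set.mem_inter_iff]
    tauto
  rw [e1, e2] at h2
  exact h2.symm.trans h1

/-- Every element of `N` distinguishes two elements of `𝓟` that agree on all separations of smaller
order. -/
def IsEfficient (N : Set (Separation G)) (𝓟 : Set (Set (Separation G))) : Prop :=
  ∀ n ∈ N, ∃ Q ∈ 𝓟, ∃ Q' ∈ 𝓟, n ∈ Q ∧ n.inv ∈ Q' ∧ ∀ m, m.order < n.order → m ∈ Q → m ∈ Q'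

variable [Finite V] {N : Set (Separation G)} {𝓟 : Set (Set (Separation G))}

/-- Among the separations of order `ℓ` that distinguish two `(ℓ + 1)`-profiles `P, P'` there is one
that is nested with `N`. -/
theorem exists_nested_distinguishing (h𝓟 : ∀ P ∈ 𝓟, IsKProfile (ℓ + 1) P) (hNn : IsNestedSet N)
    (hNi : ∀ n ∈ N, n.inv ∈ N) (hNe : IsEfficient N 𝓟) {P P' : Set (Separation G)} (hP : P ∈ 𝓟)
    (hP' : P' ∈ 𝓟) (hPP' : P ∩ N = P' ∩ N) (hne : P ≠ P') :
    ∃ s, (∀ n ∈ N, s.Nested n) ∧ s ∈ P ∧ s.inv ∈ P' := by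
  have := Separation.finite (G := G)
  have kP := h𝓟 P hP
  have kP' := h𝓟 P' hP'
  let T : Set (Separation G) := {s | s ∈ P ∧ s.inv ∈ P' ∨ s ∈ P' ∧ s.inv ∈ P}
  -- A separation in `T` crossing the fewest elements of `N` will turn out to cross none.
  let c : Separation G → ℕ := fun s => {n ∈ N | ¬ s.Nested n}.ncard
  have hT : T.Nonempty := by
    by_contra hT
    have h1 : ∀ s, s ∉ T := fun s hs => hT ⟨s, hs⟩
    refine hne (Set.ext fun s => ⟨fun h => ?_, fun h => ?_⟩)
    · exact (kP'.mem_or (kP.2.1 s h)).resolve_right fun h' => h1 s (.inl ⟨h, h'⟩)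
    · exact (kP.mem_or (kP'.2.1 s h)).resolve_right fun h' => h1 s (.inr ⟨h, h'⟩)
  have hTi : ∀ s ∈ T, s.inv ∈ T := fun s hs => hs.symm.imp And.symm And.symm
  have hTo : ∀ s ∈ T, s.order < ℓ + 1 := by
    rintro s (hs | hs)
    exacts [kP.2.1 s hs.1, kP'.2.1 s hs.1]
  obtain ⟨s, hs, hmin⟩ := WellFounded.has_min (measure c).wf T hT
  replace hmin : ∀ t ∈ T, c s ≤ c t := fun t ht => not_lt.1 (hmin t ht)
  have hci : c s.inv = c s := by simp only [c, nested_inv_left]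
  have key : ∀ s ∈ T, (∀ t ∈ T, c s ≤ c t) → ∀ n ∈ N, ¬ s.Nested n → n ∈ P → n ∈ P' →
      ℓ + 1 ≤ (s.corner n).order := by
    intro s hs hmin n hn hsn hnP hnP'
    by_contra! hlt
    have hT : s.corner n ∈ T := by
      rcases hs with hs | hs
      · exact .inl ⟨kP.corner_mem hs.1 hnP hlt, kP'.inv_mem_of_le hs.2 left_le_corner hlt⟩
      · exact .inr ⟨kP'.corner_mem hs.1 hnP' hlt, kP.inv_mem_of_le hs.2 left_le_corner hlt⟩
    -- The corner crosses only elements of `N` that `s` crosses, because these elements are nested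
    -- with `n`; and it no longer crosses `n`.
    refine (hmin _ hT).not_gt (Set.ncard_lt_ncard ?_ (Set.toFinite _))
    refine Set.ssubset_iff_of_subset ?_ |>.2 ⟨n, ⟨hn, hsn⟩, fun h => ?_⟩
    · exact fun m hm => ⟨hm.1, fun h => hm.2 (Nested.corner hsn h.symm (hNn m hm.1 n hn)).symm⟩
    · exact h.2 (nested_of_le right_le_corner).symm
  have hnest : ∀ n ∈ N, n ∈ P → s.Nested n := by
    intro n hn hnP
    by_contra hsn
    have hnP' : n ∈ P' := (hPP'.subset ⟨hnP, hn⟩).1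
    have h1 := key s hs hmin n hn hsn hnP hnP'
    have h2 := key s.inv (hTi s hs) (by rwa [hci]) n hn (by rwa [nested_inv_left]) hnP hnP'
    -- Both corners of `n` with `s` and `s.inv` have order above `ℓ`, so by submodularity both
    -- corners of `n.inv` have order below `n.order`. Efficiency gives `Q ∋ n` and `Q' ∋ n.inv` that
    -- agree there: `Q` contains the inverses of the two corners, hence so does `Q'`. But `Q'` also
    -- contains `s` or `s.inv`, against the profile property.
    have h3 := order_corner_add s n
    have h4 := order_corner_add s.inv n
    rw [order_inv, inv_inv] at h4
    have h5 := hTo s hs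
    have hno := kP.2.1 n hnP
    obtain ⟨Q, hQ, Q', hQ', h6, h7, h8⟩ := hNe n hn
    have h9 : ∀ m, n.inv ≤ m → m.order < n.order → m.inv ∈ Q' := fun m hm hlt =>
      h8 _ (by rwa [order_inv])
        ((h𝓟 Q hQ).inv_mem_of_le (s := n.inv) h6 hm (hlt.trans hno))
    rcases (h𝓟 Q' hQ').mem_or h5 with h10 | h10
    · exact (h𝓟 Q' hQ').1.2 s h10 n.inv h7 (h9 _ right_le_corner (by omega))
    · exact (h𝓟 Q' hQ').1.2 s.inv h10 n.inv h7 (h9 _ right_le_corner (by omega))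
  have hnest' : ∀ n ∈ N, s.Nested n := by
    intro n hn
    obtain ⟨Q, hQ, -, -, h6, -⟩ := hNe n hn
    rcases kP.mem_or ((h𝓟 Q hQ).2.1 n h6) with h | h
    · exact hnest n hn h
    · exact nested_inv_right.1 (hnest _ (hNi n hn) h)
  rcases hs with hs | hs
  · exact ⟨s, hnest', hs⟩
  · exact ⟨s.inv, fun n hn => (hnest' n hn).inv_left, hs.2, hs.1⟩

/-- The tasks that arise in the recursive definition of `kDetermined` are feasible. -/
theorem isFeasible_splitting (h𝓟 : ∀ P ∈ 𝓟, IsKProfile (ℓ + 1) P) (hNn : IsNestedSet N)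
    (hNi : ∀ n ∈ N, n.inv ∈ N) (hNe : IsEfficient N 𝓟)
    (hagree : ∀ P ∈ 𝓟, ∀ P' ∈ 𝓟, P ∩ N = P' ∩ N → restrictOrder ℓ P = restrictOrder ℓ P')
    (O : Set (Separation G)) :
    IsFeasible (splitting {s | s.IsProper ∧ s.order = ℓ ∧ ∀ t ∈ N, s.Nested t} O)
      (inducing 𝓟 N O) where
  proper s hs := hs.1.1
  inv_mem s hs := ⟨⟨hs.1.1.inv, (order_inv s).trans hs.1.2.1, fun t ht => (hs.1.2.2 t ht).inv_left⟩,
    hs.2.inv⟩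
  consistent P hP := (h𝓟 P hP.1).consistent
  orients P hP s hs := (h𝓟 P hP.1).mem_or (hs.1.2.1.trans_lt ℓ.lt_succ_self)
  distinguished P hP P' hP' hne := by
    have hPP' := hP.2.trans hP'.2.symm
    obtain ⟨s, h1, h2, h3⟩ := exists_nested_distinguishing h𝓟 hNn hNi hNe hP.1 hP'.1 hPP' hne
    have cP := (h𝓟 P hP.1).consistent
    have cP' := (h𝓟 P' hP'.1).consistent
    refine ⟨s, ⟨⟨isProper_of_mem cP cP' h2 h3, ?_, h1⟩, splits_of_mem cP cP'
      (hP.2 ▸ Set.inter_subset_left) (hP'.2 ▸ Set.inter_subset_left) h2 h3⟩, h2, h3⟩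
    -- The order is exactly `ℓ`, since `P` and `P'` agree on all smaller orders.
    refine (Nat.lt_succ_iff.1 ((h𝓟 P hP.1).2.1 s h2)).eq_or_lt.resolve_right fun hlt => ?_
    exact cP'.inv_notMem ((hagree P hP.1 P' hP'.1 hPP').subset ⟨h2, hlt⟩).1 h3
  corner s hs t ht hst P hP P' hP' h1 h2 h3 h4 := by
    have hPP' := hagree P hP.1 P' hP'.1 (hP.2.trans hP'.2.symm)
    have kP := h𝓟 P hP.1
    have kP' := h𝓟 P' hP'.1
    refine ⟨s.corner t, ?_, le_rfl⟩
    have h5 := order_corner_add s t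
    rw [hs.1.2.1, ht.1.2.1] at h5
    have hle : (s.corner t).order < ℓ + 1 := by
      -- If the corner had order above `ℓ`, the opposite corner would have order below `ℓ` and lie
      -- in `P'`, hence in `P`; but it lies above `s.inv`, while `s ∈ P`.
      by_contra! hgt
      have h6 : (s.inv.corner t.inv).order < ℓ := by omega
      have h7 := kP'.corner_mem h3 h4 (h6.trans ℓ.lt_succ_self)
      have h8 := (hPP'.superset ⟨h7, h6⟩).1
      exact kP.consistent.not_inv_le h8 h1 left_le_corner
    have h6 := kP.corner_mem h1 h2 hle
    have h7 := kP'.inv_mem_of_le h3 left_le_corner hle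
    refine ⟨h6, ⟨isProper_of_mem kP.consistent kP'.consistent h6 h7, ?_, fun n hn => ?_⟩,
      splits_of_mem kP.consistent kP'.consistent (hP.2 ▸ Set.inter_subset_left)
        (hP'.2 ▸ Set.inter_subset_left) h6 h7⟩
    · refine (Nat.lt_succ_iff.1 hle).eq_or_lt.resolve_right fun hlt => ?_
      exact kP'.consistent.inv_notMem (hPP'.subset ⟨h6, hlt⟩).1 h7
    · exact (Nested.corner hst (hs.1.2.2 n hn).symm (ht.1.2.2 n hn).symm).symm

/-- One level of the recursion. New elements are efficient because the profiles of a subtask agree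
on `N`, hence on all orders below `ℓ`. Describing `M` by membership lets the first level be the case
`N = ∅`. -/
theorem kDetermined_step {σ : Strategy} (hσ : ∀ n, (σ.step n).IsReducing)
    (h𝓟 : ∀ P ∈ 𝓟, IsKProfile (ℓ + 1) P) (hNn : IsNestedSet N)
    (hNi : ∀ n ∈ N, n.inv ∈ N) (hNe : IsEfficient N 𝓟)
    (hagree : ∀ P ∈ 𝓟, ∀ P' ∈ 𝓟, P ∩ N = P' ∩ N → restrictOrder ℓ P = restrictOrder ℓ P')
    {M : Set (Separation G)}
    (hM : ∀ s, s ∈ M ↔ s ∈ N ∨ ∃ O, IsConsistentOrientation N O ∧ s ∈ determined σ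
      (splitting {s | s.IsProper ∧ s.order = ℓ ∧ ∀ t ∈ N, s.Nested t} O) (inducing 𝓟 N O)) :
    IsResolving M 𝓟 ∧ IsEfficient M 𝓟 := by
  have hf := isFeasible_splitting h𝓟 hNn hNi hNe hagree
  have hd := fun O => determined_spec hσ (hf O)
  refine ⟨IsResolving.amalgamate hNi hNn (fun s hs => hs.2.2) (fun P hP => (h𝓟 P hP).consistent) ?_
    (fun O _ => (hd O).1.trans reduction_subset) (fun O _ => (hd O).2) hM, fun s hs => ?_⟩
  · intro P hP n hn
    obtain ⟨Q, hQ, -, -, h, -⟩ := hNe n hn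
    exact (h𝓟 P hP).mem_or ((h𝓟 Q hQ).2.1 n h)
  · rcases (hM s).1 hs with hs | ⟨O, -, hs⟩
    · exact hNe s hs
    · obtain ⟨⟨⟨-, ho, -⟩, -⟩, Q, hQ, Q', hQ', h1, h2⟩ :=
        (mem_reduction_iff (hf O).consistent).1 ((hd O).1 hs)
      refine ⟨Q, hQ.1, Q', hQ'.1, h1, h2, fun m hm hmQ => ?_⟩
      exact ((hagree Q hQ.1 Q' hQ'.1 (hQ.2.trans hQ'.2.symm)).subset ⟨hmQ, by omega⟩).1

/-- The main properties of the set determined by a `k`-strategy. -/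
theorem kDetermined_spec (hk : 1 ≤ k) {σ : Fin k → Strategy}
    (hσ : ∀ i n, ((σ i).step n).IsReducing) (h𝓟 : ∀ P ∈ 𝓟, IsKProfile k P) :
    IsResolving (kDetermined G k σ 𝓟) 𝓟 ∧ IsEfficient (kDetermined G k σ 𝓟) 𝓟 := by
  induction k, hk using Nat.le_induction generalizing 𝓟 with
  | base =>
    -- The empty system has just the orientation `∅`, and every proper separation splits it.
    refine kDetermined_step (σ := σ 0) (N := ∅) (ℓ := 0) (hσ 0) h𝓟 (by simp [IsNestedSet])
      (by simp) (by simp [IsEfficient]) (by simp [restrictOrder]) fun s => ?_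
    have h1 : {s : Separation G | s.IsProper ∧ s.order = 0 ∧ ∀ t ∈ (∅ : Set (Separation G)),
        s.Nested t} = {s | s.IsProper ∧ s.order < 1} := by simp
    have h2 : splitting {s : Separation G | s.IsProper ∧ s.order < 1} ∅ =
        {s | s.IsProper ∧ s.order < 1} := by
      refine (splitting_subset _ _).antisymm fun s hs => ⟨hs, (splits_iff ?_ hs.1).2 ?_⟩ <;>
        simp [IsConsistent]
    have h3 : inducing 𝓟 ∅ ∅ = 𝓟 := by simp [inducing]
    have h4 : ∀ O : Set (Separation G), IsConsistentOrientation ∅ O ↔ O = ∅ := fun O =>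
      ⟨fun h => Set.subset_empty_iff.1 h.1, by rintro rfl; simp [IsConsistentOrientation, IsConsistent]⟩
    simp only [h4, exists_eq_left]
    rw [h1, h2, h3]
    simp [kDetermined]
  | succ k hk ih =>
    obtain ⟨k, rfl⟩ : ∃ l, k = l + 1 := ⟨k - 1, by omega⟩
    have hr : ∀ P ∈ restrictOrder (k + 1) '' 𝓟, IsKProfile (k + 1) P := by
      rintro _ ⟨P, hP, rfl⟩
      exact (h𝓟 P hP).restrictOrder (Nat.le_succ _)
    obtain ⟨hN, hNe⟩ := ih (σ := Fin.init σ) (fun i => hσ _) hr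
    refine kDetermined_step (σ := σ (Fin.last (k + 1)))
      (N := kDetermined G (k + 1) (Fin.init σ) (restrictOrder (k + 1) '' 𝓟)) (hσ _) h𝓟 hN.nested
      hN.inv_mem ?_ ?_ fun s => ?_
    · intro n hn
      obtain ⟨_, ⟨Q, hQ, rfl⟩, _, ⟨Q', hQ', rfl⟩, h1, h2, h3⟩ := hNe n hn
      exact ⟨Q, hQ, Q', hQ', h1.1, h2.1, fun m hm hmQ => (h3 m hm ⟨hmQ, hm.trans h1.2⟩).1⟩
    -- Were the restrictions of two profiles different, `N` would distinguish them.
    · intro P hP P' hP' hPP'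
      by_contra hne
      obtain ⟨s, hs, h1, h2⟩ := hN.distinguished _ ⟨P, hP, rfl⟩ _ ⟨P', hP', rfl⟩ hne
      exact (h𝓟 P' hP').consistent.inv_notMem (hPP'.subset ⟨h1.1, hs⟩).1 h2.1
    · rw [kDetermined]
      simp

end KProfiles

/-! ### Walks and the two sides of a tree edge. -/

namespace SimpleGraph

variable {α : Type u} {T : SimpleGraph α} {a b c d t u v w : α} {X : Set α}

/-- The nodes on the side of `b` after deleting the edge `ab`. -/
def ahead (T : SimpleGraph α) (a b : α) : Set α := {t | (T.deleteEdges {s(a, b)}).Reachable b t}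

theorem mem_ahead_self : b ∈ T.ahead a b := Reachable.refl b

theorem Reachable.mem_iff_of_forall_adj (h : T.Reachable u v)
    (hX : ∀ x y, T.Adj x y → x ∈ X → y ∈ X) : u ∈ X → v ∈ X := by
  obtain ⟨p⟩ := h
  induction p with
  | nil => exact id
  | cons h _ ih => exact fun hu => ih (hX _ _ h hu)

/-- If `ab` is the only edge entering `X`, then a walk that leaves `X` uses `a` and `b`. -/
theorem Walk.mem_support_of_forall_adj (q : T.Walk v w)
    (hX : ∀ x y, T.Adj x y → x ∉ X → y ∈ X → x = a ∧ y = b) (hv : v ∈ X) (hw : w ∉ X) :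
    a ∈ q.support ∧ b ∈ q.support := by
  induction q with
  | nil => exact absurd hv hw
  | @cons x y z h q ih =>
    by_cases hy : y ∈ X
    · exact (ih hy hw).imp (List.mem_cons_of_mem _) (List.mem_cons_of_mem _)
    · obtain ⟨rfl, rfl⟩ := hX y x h.symm hy hv
      exact ⟨List.mem_cons_of_mem _ q.start_mem_support, List.mem_cons_self⟩

/-- If `ab` is the only edge entering `X`, then a path with both ends outside `X` avoids `X`. -/
theorem Walk.IsPath.notMem_of_forall_adj {p : T.Walk u w} (hp : p.IsPath)
    (hX : ∀ x y, T.Adj x y → x ∉ X → y ∈ X → x = a ∧ y = b) (hu : u ∉ X) (hw : w ∉ X)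
    (ht : t ∈ p.support) : t ∉ X := by
  induction p with
  | nil =>
    rw [Walk.support_nil, List.mem_singleton] at ht
    rwa [ht]
  | @cons x y z h q ih =>
    rw [Walk.cons_isPath_iff] at hp
    rw [Walk.support_cons, List.mem_cons] at ht
    rcases ht with rfl | ht
    · exact hu
    · refine ih hp.1 (fun hy => hp.2 ?_) hw ht
      rw [(hX x y h hu hy).1]
      exact (q.mem_support_of_forall_adj hX hy hw).1

theorem Connected.mem_ahead_or (h : T.Connected) (a b t : α) : t ∈ T.ahead a b ∨ t ∈ T.ahead b a := by
  refine (h.preconnected b t).mem_iff_of_forall_adj (X := T.ahead a b ∪ T.ahead b a) ?_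
    (.inl mem_ahead_self)
  intro x y hxy hx
  by_cases he : s(x, y) = s(a, b)
  · rcases Sym2.eq_iff.1 he with ⟨-, rfl⟩ | ⟨-, rfl⟩
    exacts [.inl mem_ahead_self, .inr mem_ahead_self]
  · rcases hx with hx | hx
    · refine .inl (hx.trans (Adj.reachable ?_))
      rw [deleteEdges_adj]
      exact ⟨hxy, he⟩
    · refine .inr (hx.trans (Adj.reachable ?_))
      rw [deleteEdges_adj, Sym2.eq_swap (a := b)]
      exact ⟨hxy, he⟩

theorem ahead_eq_compl (h : T.Connected) (hb : ∀ x ∈ T.ahead a b, x ∉ T.ahead b a) :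
    T.ahead b a = (T.ahead a b)ᶜ :=
  Set.ext fun t => ⟨fun h1 h2 => hb t h2 h1, (h.mem_ahead_or a b t).resolve_left⟩

theorem eq_of_adj_of_mem_ahead (huv : T.Adj u v) (hu : u ∉ T.ahead a b)
    (hv : v ∈ T.ahead a b) : u = a ∧ v = b := by
  by_cases he : s(u, v) = s(a, b)
  · rcases Sym2.eq_iff.1 he with he | ⟨rfl, rfl⟩
    exacts [he, absurd mem_ahead_self hu]
  · refine absurd (hv.trans (Adj.reachable ?_)) hu
    rw [deleteEdges_adj, Sym2.eq_swap (a := v)]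
    exact ⟨huv.symm, he⟩

namespace IsTree

variable (h : T.IsTree)
include h

theorem notMem_ahead (hab : T.Adj a b) : a ∉ T.ahead a b := fun h1 =>
  isBridge_iff.1 (isAcyclic_iff_forall_adj_isBridge.1 h.isAcyclic hab) h1.symm

theorem ahead_swap (hab : T.Adj a b) : T.ahead b a = (T.ahead a b)ᶜ := by
  refine ahead_eq_compl h.connected fun x h1 h2 => h.notMem_ahead hab ?_
  rw [ahead, Set.mem_ofPred_eq, Sym2.eq_swap] at h2
  exact h1.trans h2.symm

/-- No walk inside the side of `b` uses the edge `cd`, so that side stays connected when `cd` is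
deleted. -/
theorem ahead_subset_or (hcd : T.Adj c d) (hc : c ∉ T.ahead a b)
    (hd : d ∉ T.ahead a b) : T.ahead a b ⊆ T.ahead c d ∨ T.ahead a b ⊆ T.ahead d c := by
  have key : ∀ t ∈ T.ahead a b, (T.deleteEdges {s(c, d)}).Reachable b t := by
    intro t ht
    refine (Reachable.mem_iff_of_forall_adj (X := T.ahead a b ∩
      {t | (T.deleteEdges {s(c, d)}).Reachable b t}) ht ?_ ⟨mem_ahead_self, Reachable.refl b⟩).2
    rintro x y hxy ⟨hx, hx'⟩
    refine ⟨hx.trans hxy.reachable, hx'.trans (Adj.reachable ?_)⟩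
    rw [deleteEdges_adj] at hxy ⊢
    refine ⟨hxy.1, fun he => ?_⟩
    rcases Sym2.eq_iff.1 he with ⟨rfl, -⟩ | ⟨rfl, -⟩
    exacts [hc hx, hd hx]
  by_cases hb : b ∈ T.ahead c d
  · exact .inl fun t ht => hb.trans (key t ht)
  · right
    rw [h.ahead_swap hcd]
    exact fun t ht h1 => hb (h1.trans (key t ht).symm)

/-- The two sides of two distinct edges are nested. -/
theorem ahead_nested (hab : T.Adj a b) (hcd : T.Adj c d) (h1 : ¬ (c = a ∧ d = b))
    (h2 : ¬ (c = b ∧ d = a)) :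
    (T.ahead a b ⊆ T.ahead c d ∨ T.ahead a b ⊆ (T.ahead c d)ᶜ) ∨
      (T.ahead a b)ᶜ ⊆ T.ahead c d ∨ (T.ahead a b)ᶜ ⊆ (T.ahead c d)ᶜ := by
  simp only [← h.ahead_swap hab, ← h.ahead_swap hcd]
  by_cases hc : c ∈ T.ahead a b <;> by_cases hd : d ∈ T.ahead a b
  · refine .inr (h.ahead_subset_or hcd ?_ ?_) <;> simpa [h.ahead_swap hab]
  · exact absurd (eq_of_adj_of_mem_ahead hcd.symm hd hc).symm h2
  · exact absurd (eq_of_adj_of_mem_ahead hcd hc hd) h1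
  · exact .inl (h.ahead_subset_or hcd hc hd)

end IsTree

/-- A walk that ends in `X` enters `X` through an edge `vw` whose deletion leaves its first vertex on
the side of `v`. -/
theorem Walk.exists_adj_mem (p : T.Walk t u) (ht : t ∉ X) (hu : u ∈ X) :
    ∃ v w, T.Adj w v ∧ v ∉ X ∧ w ∈ X ∧ t ∈ T.ahead w v := by
  induction p with
  | nil => exact absurd hu ht
  | @cons x y z h q ih =>
    by_cases hy : y ∈ X
    · exact ⟨x, y, h.symm, ht, hy, mem_ahead_self⟩
    · obtain ⟨v, w, hwv, hv, hw, hyw⟩ := ih hy hu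
      refine ⟨v, w, hwv, hv, hw, hyw.trans (Adj.reachable ?_)⟩
      rw [deleteEdges_adj]
      refine ⟨h.symm, fun he => ?_⟩
      rcases Sym2.eq_iff.1 he with ⟨rfl, -⟩ | ⟨-, rfl⟩
      exacts [hy hw, ht hw]

end SimpleGraph

/-! ### The tree of consistent orientations. -/

section TreeSets

open Separation

variable {V : Type u} {G : SimpleGraph V} {N O O' : Set (Separation G)} {s t : Separation G}

/-- A symmetric nested set of proper separations. -/
structure IsTreeSet (N : Set (Separation G)) : Prop where
  proper : ∀ s ∈ N, s.IsProper
  inv_mem : ∀ s ∈ N, s.inv ∈ N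
  nested : IsNestedSet N

/-- The consistent orientation of a tree set in which `s` is maximal and its inverse could replace it. -/
def principalOrientation (N : Set (Separation G)) (s : Separation G) : Set (Separation G) :=
  {t ∈ N | t ≤ s ∨ t < s.inv}

/-- The consistent orientations of `N`. -/
abbrev Orientations (N : Set (Separation G)) :=
  {O : Set (Separation G) // IsConsistentOrientation N O}

/-- Nestedness with `s` decides how each `t` is oriented. The inequality `t < s.inv` must be strict
to keep `s.inv` out. -/
theorem IsTreeSet.isConsistentOrientation (hN : IsTreeSet N) (hs : s ∈ N) :
    IsConsistentOrientation N (principalOrientation N s) := by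
  have hp := hN.proper s hs
  refine ⟨fun t ht => ht.1, isConsistent_iff.2 ?_, fun t ht => ?_⟩
  · rintro x ⟨-, hx | hx⟩ y ⟨-, hy | hy⟩ hyx
    · exact hp.not_inv_le ((inv_le_inv.2 hy).trans (hyx.trans hx))
    · exact hy.not_ge (inv_le_iff.1 (hyx.trans hx))
    · have h1 : s.inv ≤ x := (inv_le_inv.2 hy).trans hyx
      exact hx.not_ge h1
    · exact hp.not_le_inv ((le_inv_iff.1 hy.le).trans (hyx.trans hx.le))
  · by_cases hts : t = s.inv
    · exact .inr ⟨hN.inv_mem t ht, .inl (inv_eq_iff.2 hts).le⟩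
    by_cases hts' : t = s
    · exact .inl ⟨ht, .inl hts'.le⟩
    rcases hN.nested t ht s hs with (h | h) | (h | h)
    · exact .inl ⟨ht, .inl h⟩
    · exact .inr ⟨hN.inv_mem t ht, .inr ((inv_le_inv.2 h).lt_of_ne fun h' =>
        hts' (inv_injective h'))⟩
    · exact .inl ⟨ht, .inr (h.lt_of_ne hts)⟩
    · exact .inr ⟨hN.inv_mem t ht, .inl (inv_le_iff.1 h)⟩

/-- `O'` arises from `O` by replacing `s` with its inverse. -/
def IsFlip (s : Separation G) (O O' : Set (Separation G)) : Prop :=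
  s ∈ O ∧ s.inv ∈ O' ∧ O \ {s} = O' \ {s.inv}

theorem IsFlip.symm (h : IsFlip s O O') : IsFlip s.inv O' O := ⟨h.2.1, h.1, h.2.2.symm⟩

theorem isFlip_principal (hN : IsTreeSet N) (hs : s ∈ N) :
    IsFlip s (principalOrientation N s) (principalOrientation N s.inv) := by
  refine ⟨⟨hs, .inl le_rfl⟩, ⟨hN.inv_mem s hs, .inl le_rfl⟩, Set.ext fun t => ?_⟩
  have h1 := (hN.proper s hs).not_inv_le
  have h2 := (hN.proper s hs).not_le_inv
  simp only [principalOrientation, Set.mem_sdiff, Set.mem_ofPred_eq, Set.mem_singleton_iff, inv_inv]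
  constructor
  · rintro ⟨⟨ht, h | h⟩, hne⟩
    · exact ⟨⟨ht, .inr (h.lt_of_ne hne)⟩, by rintro rfl; exact h1 h⟩
    · exact ⟨⟨ht, .inl h.le⟩, h.ne⟩
  · rintro ⟨⟨ht, h | h⟩, hne⟩
    · exact ⟨⟨ht, .inr (h.lt_of_ne hne)⟩, by rintro rfl; exact h2 h⟩
    · exact ⟨⟨ht, .inl h.le⟩, h.ne⟩

/-- Every `t ∈ O` other than `s` also lies in `O'`, so it is consistent with both `s` and `s.inv`;
nestedness leaves only `t ≤ s` or `t < s.inv`. Thus `s` determines both ends of its edge. -/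
theorem IsFlip.eq_principal (hN : IsTreeSet N) (hO : IsConsistentOrientation N O)
    (hO' : IsConsistentOrientation N O') (h : IsFlip s O O') : O = principalOrientation N s := by
  have hs := hO.1 h.1
  have hsub : O ⊆ principalOrientation N s := by
    intro t ht
    refine ⟨hO.1 ht, ?_⟩
    by_cases hts : t = s
    · exact .inl hts.le
    have ht' : t ∈ O' := (h.2.2.subset ⟨ht, hts⟩).1
    rcases hN.nested t (hO.1 ht) s hs with (h1 | h1) | (h1 | h1)
    · exact .inl h1
    · exact absurd h1 (hO'.2.1.not_inv_le ht' h.2.1)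
    · refine .inr (h1.lt_of_ne fun h2 => ?_)
      exact hO.2.1.inv_notMem h.1 (h2 ▸ ht)
    · exact absurd h1 (hO.2.1.not_inv_le ht h.1)
  refine hsub.antisymm fun t ht => (hO.2.2 t ht.1).resolve_right fun h1 => ?_
  exact (hN.isConsistentOrientation hs).2.1.inv_notMem ht (hsub h1)

variable (N) in
/-- The graph on the consistent orientations of `N` in which two orientations are adjacent if they
differ in the orientation of precisely one separation. -/
def orientationGraph : SimpleGraph (Orientations N) where
  Adj O O' := ∃ s, IsFlip s O.1 O'.1
  symm := ⟨fun _ _ ⟨s, h⟩ => ⟨s.inv, h.symm⟩⟩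
  loopless := ⟨fun O ⟨_, h⟩ => O.2.2.1.inv_notMem h.1 h.2.1⟩

/-- A principal orientation as a node of the orientation graph. -/
def IsTreeSet.principal (hN : IsTreeSet N) (hs : s ∈ N) :
    Orientations N :=
  ⟨principalOrientation N s, hN.isConsistentOrientation hs⟩

theorem IsTreeSet.adj_principal (hN : IsTreeSet N) (hs : s ∈ N) :
    (orientationGraph N).Adj (hN.principal (hN.inv_mem s hs)) (hN.principal hs) :=
  ⟨s.inv, (isFlip_principal hN hs).symm⟩

/-- The set of orientations containing `s` can be entered through one edge only, as the walk lemmas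
require. -/
theorem IsTreeSet.eq_principal_of_adj (hN : IsTreeSet N) (hs : s ∈ N)
    {A B : Orientations N}
    (h : (orientationGraph N).Adj A B) (hA : s ∉ A.1) (hB : s ∈ B.1) :
    A = hN.principal (hN.inv_mem s hs) ∧ B = hN.principal hs := by
  obtain ⟨r, hr⟩ := h
  have hsr : s = r.inv := by
    by_contra hne
    exact hA (hr.2.2.superset ⟨hB, hne⟩).1
  obtain rfl : r = s.inv := by rw [hsr, inv_inv]
  exact ⟨Subtype.ext (hr.eq_principal hN A.2 B.2), Subtype.ext (hr.symm.eq_principal hN B.2 A.2)⟩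

/-- Inverting a maximal `s` of `A \ B` brings `A` closer to `B`. It preserves consistency: an
element of `A` above `s` cannot lie in `B`, which contains `s.inv`, so by maximality it is `s`. -/
theorem IsTreeSet.reachable [Finite V] (hN : IsTreeSet N)
    (A B : Orientations N) :
    (orientationGraph N).Reachable A B := by
  have := Separation.finite (G := G)
  induction hn : (A.1 \ B.1).ncard using Nat.strong_induction_on generalizing A with
  | _ n ih =>
    subst hn
    rcases (A.1 \ B.1).eq_empty_or_nonempty with he | ⟨x, hx⟩
    · have hsub : A.1 ⊆ B.1 := Set.sdiff_eq_empty.1 he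
      have : A = B := Subtype.ext <| hsub.antisymm fun t ht =>
        (A.2.2.2 t (B.2.1 ht)).resolve_right fun h => B.2.2.1.inv_notMem ht (hsub h)
      rw [this]
    obtain ⟨s, -, hs⟩ := (Set.toFinite (A.1 \ B.1)).exists_le_maximal hx
    have hsN := A.2.1 hs.1.1
    have hsB : s.inv ∈ B.1 := (B.2.2.2 s hsN).resolve_left hs.1.2
    have hflip : IsConsistentOrientation N ((A.1 \ {s}) ∪ {s.inv}) := by
      refine ⟨Set.union_subset (Set.sdiff_subset.trans A.2.1)
        (Set.singleton_subset_iff.2 (hN.inv_mem s hsN)), ?_, fun t ht => ?_⟩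
      · rw [isConsistent_insert_iff (A.2.2.1.mono Set.sdiff_subset)]
        refine ⟨(hN.proper s hsN).not_le_inv, fun t ht hst => ?_⟩
        by_cases htB : t ∈ B.1
        · exact B.2.2.1.not_inv_le htB hsB hst
        · exact ht.2 (le_antisymm (hs.2 ⟨ht.1, htB⟩ hst) hst)
      · by_cases h1 : t = s
        · exact .inr (.inr (h1 ▸ rfl))
        by_cases h2 : t = s.inv
        · exact .inl (.inr h2)
        · refine (A.2.2.2 t ht).imp (fun h => .inl ⟨h, h1⟩) fun h => .inl ⟨h, fun h3 => h2 ?_⟩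
          exact inv_eq_iff.1 h3
    have hne : s.inv ∉ A.1 := A.2.2.1.inv_notMem hs.1.1
    have hadj : (orientationGraph N).Adj A ⟨_, hflip⟩ := by
      refine ⟨s, hs.1.1, .inr rfl, Set.ext fun t => ?_⟩
      simp only [Set.mem_sdiff, Set.mem_union, Set.mem_singleton_iff]
      constructor
      · exact fun h => ⟨.inl h, fun h' => hne (h' ▸ h.1)⟩
      · exact fun h => h.1.resolve_right h.2
    refine hadj.reachable.trans (ih _ (Set.ncard_lt_ncard ?_ (Set.toFinite _)) _ rfl)
    refine Set.ssubset_iff_of_subset ?_ |>.2 ⟨s, hs.1, fun h => ?_⟩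
    · rintro t ⟨ht | rfl, htB⟩
      exacts [⟨ht.1, htB⟩, absurd hsB htB]
    · rcases h.1 with h | h
      exacts [h.2 rfl, (hN.proper s hsN).ne_inv h]

/-- Every set of vertices that is not separated by `N` is oriented towards by some consistent
orientation of `N`. -/
theorem IsTreeSet.exists_orientation_of_mem (hN : IsTreeSet N) {X : Set V}
    (hX : ∀ s ∈ N, X ⊆ s.left ∨ X ⊆ s.right) (hs : s ∈ N) (hXs : X ⊆ s.right) :
    ∃ O, IsConsistentOrientation N O ∧ s ∈ O ∧ ∀ t ∈ O, X ⊆ t.right := by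
  have hO := hN.isConsistentOrientation hs
  -- Ties, where `X` lies in both sides, are broken by the principal orientation. If `y.inv ≤ x` and
  -- both point to `X`, both are ties, so consistency is inherited from there.
  refine ⟨{t ∈ N | X ⊆ t.right ∧ (X ⊆ t.left → t ∈ principalOrientation N s)},
    ⟨fun t ht => ht.1, isConsistent_iff.2 fun x hx y hy hyx => ?_, fun t ht => ?_⟩,
    ⟨hs, hXs, fun _ => ⟨hs, .inl le_rfl⟩⟩, fun t ht => ht.2.1⟩
  · exact hO.2.1.not_inv_le (hx.2.2 (hy.2.1.trans hyx.1)) (hy.2.2 (hx.2.1.trans hyx.2)) hyx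
  · by_cases h1 : X ⊆ t.left <;> by_cases h2 : X ⊆ t.right
    · exact (hO.2.2 t ht).imp (fun h => ⟨ht, h2, fun _ => h⟩)
        fun h => ⟨hN.inv_mem t ht, h1, fun _ => h⟩
    · exact .inr ⟨hN.inv_mem t ht, h1, fun h => absurd h h2⟩
    · exact .inl ⟨ht, h2, fun h => absurd h h1⟩
    · exact absurd (hX t ht) (by tauto)

theorem IsTreeSet.exists_orientation (hN : IsTreeSet N) {X : Set V}
    (hX : ∀ s ∈ N, X ⊆ s.left ∨ X ⊆ s.right) :
    ∃ O, IsConsistentOrientation N O ∧ ∀ t ∈ O, X ⊆ t.right := by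
  rcases N.eq_empty_or_nonempty with rfl | ⟨s, hs⟩
  · exact ⟨∅, by simp [IsConsistentOrientation, IsConsistent], by simp⟩
  · rcases hX s hs with h | h
    · obtain ⟨O, hO, -, h⟩ := hN.exists_orientation_of_mem hX (hN.inv_mem s hs) h
      exact ⟨O, hO, h⟩
    · obtain ⟨O, hO, -, h⟩ := hN.exists_orientation_of_mem hX hs h
      exact ⟨O, hO, h⟩

theorem IsTreeSet.ahead_principal_subset (hN : IsTreeSet N) (hs : s ∈ N)
    {A : Orientations N}
    (hA : A ∈ (orientationGraph N).ahead (hN.principal (hN.inv_mem s hs)) (hN.principal hs)) :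
    s ∈ A.1 := by
  refine SimpleGraph.Reachable.mem_iff_of_forall_adj (X := {A : Orientations N | s ∈ A.1}) hA ?_
    (isFlip_principal hN hs).1
  intro x y hxy hx
  rw [SimpleGraph.deleteEdges_adj] at hxy
  by_contra hy
  have := hN.eq_principal_of_adj hs hxy.1.symm hy hx
  exact hxy.2 (by rw [← this.1, ← this.2, Sym2.eq_swap]; rfl)

theorem IsTreeSet.connected [Finite V] (hN : IsTreeSet N) : (orientationGraph N).Connected := by
  have hne : Nonempty (Orientations N) := by
    obtain ⟨O, hO, -⟩ := hN.exists_orientation (X := ∅) (by simp)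
    exact ⟨⟨O, hO⟩⟩
  exact ⟨hN.reachable⟩

theorem IsTreeSet.ahead_principal [Finite V] (hN : IsTreeSet N) (hs : s ∈ N) :
    (orientationGraph N).ahead (hN.principal (hN.inv_mem s hs)) (hN.principal hs) =
      {A : Orientations N | s ∈ A.1} := by
  refine Set.Subset.antisymm (fun A hA => hN.ahead_principal_subset hs hA) fun A hA => ?_
  refine (hN.connected.mem_ahead_or _ _ A).resolve_right fun h => ?_
  exact A.2.2.1.inv_notMem hA (hN.ahead_principal_subset (hN.inv_mem s hs) h)

/-- A walk avoiding the edge that inverts `s` cannot change the orientation of `s`, so every edge is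
a bridge. -/
theorem IsTreeSet.isTree [Finite V] (hN : IsTreeSet N) : (orientationGraph N).IsTree := by
  refine ⟨hN.connected, SimpleGraph.isAcyclic_iff_forall_adj_isBridge.2 fun A B hAB => ?_⟩
  rw [SimpleGraph.isBridge_iff]
  obtain ⟨s, hs⟩ := hAB
  have hsN := A.2.1 hs.1
  have hA : A = hN.principal hsN := Subtype.ext (hs.eq_principal hN A.2 B.2)
  have hB : B = hN.principal (hN.inv_mem s hsN) := Subtype.ext (hs.symm.eq_principal hN B.2 A.2)
  rw [hA, hB]
  intro h
  have := hN.ahead_principal_subset (hN.inv_mem s hsN) (A := hN.principal hsN) h.symm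
  exact (hN.isConsistentOrientation hsN).2.1.inv_notMem (isFlip_principal hN hsN).1 this

theorem Separation.subset_or_of_adj {x y : V} (h : G.Adj x y) (s : Separation G) :
    {x, y} ⊆ s.left ∨ {x, y} ⊆ s.right := by
  have hs : ∀ x, x ∈ s.left ∨ x ∈ s.right := fun x => by
    have : x ∈ s.left ∪ s.right := s.union_eq ▸ Set.mem_univ x
    exact this
  have h1 := s.no_edge x
  have h2 := s.no_edge y
  have := hs x
  have := hs y
  simp only [Set.insert_subset_iff, Set.singleton_subset_iff, Set.mem_sdiff] at *
  by_contra! hc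
  by_cases hx : x ∈ s.left
  · have hy : y ∉ s.left := fun hy => hc.1 hx hy
    have hy' : y ∈ s.right := (hs y).resolve_left hy
    exact h1 ⟨hx, fun h' => hc.2 h' hy'⟩ y ⟨hy', hy⟩ h
  · have hx' : x ∈ s.right := (hs x).resolve_left hx
    have hy : y ∉ s.right := fun hy => hc.2 hx' hy
    exact h2 ⟨(hs y).resolve_right hy, hy⟩ x ⟨hx', hx⟩ h.symm

theorem Separation.singleton_subset_or (x : V) (s : Separation G) :
    {x} ⊆ s.left ∨ {x} ⊆ s.right := by
  have : x ∈ s.left ∪ s.right := s.union_eq ▸ Set.mem_univ x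
  simpa using this

/-- The tree-decomposition whose nodes are the consistent orientations of a tree set. -/
def IsTreeSet.treeDecomposition [Finite V] (hN : IsTreeSet N) : TreeDecomposition G where
  Node := Orientations N
  finite_node := by
    have := Separation.finite (G := G)
    infer_instance
  tree := orientationGraph N
  isTree := hN.isTree
  part A := {x | ∀ s ∈ A.1, x ∈ s.right}
  iUnion_part := by
    refine Set.eq_univ_of_forall fun x => ?_
    obtain ⟨O, hO, h⟩ := hN.exists_orientation fun s _ => s.singleton_subset_or x
    exact Set.mem_iUnion.2 ⟨⟨O, hO⟩, fun s hs => h s hs rfl⟩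
  exists_part_of_adj x y hxy := by
    obtain ⟨O, hO, h⟩ := hN.exists_orientation fun s _ => s.subset_or_of_adj hxy
    exact ⟨⟨O, hO⟩, fun s hs => h s hs (.inl rfl), fun s hs => h s hs (.inr rfl)⟩
  inter_subset_of_mem_path := by
    rintro A B C p hp hB x ⟨hA, hC⟩ s hs
    -- A vertex outside `s.right` puts `s` outside both end orientations, so the path never enters
    -- the set of orientations containing `s`.
    by_contra hx
    have hsN := B.2.1 hs
    refine hp.notMem_of_forall_adj (X := {A : Orientations N | s ∈ A.1})
      (a := hN.principal (hN.inv_mem s hsN)) (b := hN.principal hsN)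
      (fun A B hxy hx hy => hN.eq_principal_of_adj hsN hxy hx hy) (fun h => hx (hA s h))
      (fun h => hx (hC s h)) hB hs

end TreeSets

open Separation

/-! ### Uniqueness of the tree-decomposition inducing a tree set. -/

namespace TreeDecomposition

variable {V : Type u} {G : SimpleGraph V} {D : TreeDecomposition G} {s s' : Separation G}
  {e e' : D.tree.Dart} {N : Set (Separation G)}

theorem Induces.mem_right (h : D.Induces e s) {x : V} :
    x ∈ s.right ↔ ∃ t ∈ D.tree.ahead e.fst e.snd, x ∈ D.part t := by
  rw [h.2]
  simp [side, SimpleGraph.ahead]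

theorem Induces.mem_left (h : D.Induces e s) {x : V} :
    x ∈ s.left ↔ ∃ t ∈ D.tree.ahead e.snd e.fst, x ∈ D.part t := by
  rw [h.1]
  simp [side, SimpleGraph.ahead, Sym2.eq_swap (a := e.snd)]

theorem induces_iff : D.Induces e s ↔
    (∀ x, x ∈ s.left ↔ ∃ t ∈ D.tree.ahead e.snd e.fst, x ∈ D.part t) ∧
    ∀ x, x ∈ s.right ↔ ∃ t ∈ D.tree.ahead e.fst e.snd, x ∈ D.part t := by
  refine ⟨fun h => ⟨fun x => h.mem_left, fun x => h.mem_right⟩, fun h => ⟨?_, ?_⟩⟩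
  · ext x
    rw [h.1]
    simp [side, SimpleGraph.ahead, Sym2.eq_swap (a := e.snd)]
  · ext x
    rw [h.2]
    simp [side, SimpleGraph.ahead]

theorem Induces.symm (h : D.Induces e s) : D.Induces e.symm s.inv :=
  induces_iff.2 ⟨fun _ => h.mem_right, fun _ => h.mem_left⟩

theorem Induces.eq (h : D.Induces e s) (h' : D.Induces e s') : s = s' :=
  Separation.ext (h.1.trans h'.1.symm) (h.2.trans h'.2.symm)

theorem IsInducing.mem (hD : D.IsInducing N) (h : D.Induces e s) : s ∈ N := by
  obtain ⟨s', hs', h'⟩ := hD.1 e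
  exact h.eq h' ▸ hs'

theorem IsInducing.eq_dart (hD : D.IsInducing N) (h : D.Induces e s) (h' : D.Induces e' s) :
    e = e' :=
  (hD.2 s (hD.mem h)).unique h h'

theorem IsInducing.inducedSet_eq (hD : D.IsInducing N) : D.inducedSet = N :=
  Set.ext fun s => ⟨fun ⟨_, h⟩ => hD.mem h, fun h => (hD.2 s h).exists⟩

theorem IsInducing.adhesionLT [Finite V] (hD : D.IsInducing N) {k : ℕ} (hN : ∀ s ∈ N, s.order < k) :
    D.AdhesionLT k := by
  intro t t' h
  obtain ⟨s, hs, hi⟩ := hD.1 ⟨(t, t'), h⟩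
  refine (Set.ncard_le_ncard ?_ (Set.toFinite _)).trans_lt (hN s hs)
  rintro x ⟨hx, hx'⟩
  exact ⟨hi.mem_left.2 ⟨t, SimpleGraph.mem_ahead_self, hx⟩,
    hi.mem_right.2 ⟨t', SimpleGraph.mem_ahead_self, hx'⟩⟩

/-- The separations in `N` that are induced by an edge oriented towards the node `t`. -/
def orientation (D : TreeDecomposition G) (N : Set (Separation G)) (t : D.Node) :
    Set (Separation G) :=
  {s ∈ N | ∃ e, D.Induces e s ∧ t ∈ D.tree.ahead e.fst e.snd}

/-- If `y.inv ≤ x` with both edges pointing to `t`, nested sides beyond the edges make `x` or `y`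
improper. Otherwise `y.inv = x`, and bijectivity makes the edges inverse to each other, so they
cannot both point to `t`. -/
theorem isConsistentOrientation_orientation (hN : IsTreeSet N) (hD : D.IsInducing N) (t : D.Node) :
    IsConsistentOrientation N (D.orientation N t) := by
  refine ⟨fun s hs => hs.1, isConsistent_iff.2 ?_, fun s hs => ?_⟩
  · rintro x ⟨hx, e, he, hte⟩ y ⟨hy, f, hf, htf⟩ hyx
    by_cases h1 : f.fst = e.fst ∧ f.snd = e.snd
    · obtain rfl : f = e := SimpleGraph.Dart.ext _ _ (Prod.ext h1.1 h1.2)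
      exact (hN.proper x hx).not_inv_le (hf.eq he ▸ hyx)
    by_cases h2 : f.fst = e.snd ∧ f.snd = e.fst
    · rw [h2.1, h2.2, D.isTree.ahead_swap e.adj] at htf
      exact htf hte
    have hswap := D.isTree.ahead_swap e.adj
    have hswap' := D.isTree.ahead_swap f.adj
    rcases D.isTree.ahead_nested e.adj f.adj h1 h2 with (h | h) | (h | h)
    · have hr : x.right ⊆ y.right := fun v hv => by
        obtain ⟨u, hu, hv⟩ := he.mem_right.1 hv
        exact hf.mem_right.2 ⟨u, h hu, hv⟩
      exact (hN.proper x hx).2 (hr.trans hyx.1)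
    · exact h hte htf
    · have hl : x.left ⊆ y.right := fun v hv => by
        obtain ⟨u, hu, hv⟩ := he.mem_left.1 hv
        exact hf.mem_right.2 ⟨u, h (hswap ▸ hu), hv⟩
      have hr : y.left ⊆ x.right := fun v hv => by
        obtain ⟨u, hu, hv⟩ := hf.mem_left.1 hv
        exact he.mem_right.2 ⟨u, Set.compl_subset_comm.1 h (hswap' ▸ hu), hv⟩
      have hxy : y.inv = x := le_antisymm hyx ⟨hl, hr⟩
      have := hD.eq_dart he (hxy ▸ hf.symm)
      exact h2 ⟨by rw [this]; rfl, by rw [this]; rfl⟩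
    · have hr : y.right ⊆ x.right := fun v hv => by
        obtain ⟨u, hu, hv⟩ := hf.mem_right.1 hv
        exact he.mem_right.2 ⟨u, Set.compl_subset_compl.1 h hu, hv⟩
      exact (hN.proper y hy).2 (hr.trans hyx.2)
  · obtain ⟨e, he⟩ := (hD.2 s hs).exists
    rcases D.isTree.connected.mem_ahead_or e.fst e.snd t with h | h
    · exact .inl ⟨hs, e, he, h⟩
    · exact .inr ⟨hN.inv_mem s hs, e.symm, he.symm, h⟩

/-- If `x` is missing from the part at `t`, a walk from `t` to a part containing `x` enters such
parts along an edge `vw` with `t` on the side of `v`. Were `x` in some part on that side, the path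
from there to `w` would put `x` into the part at `v`. -/
theorem IsInducing.mem_part_iff (hD : D.IsInducing N) {t : D.Node} {x : V} :
    x ∈ D.part t ↔ ∀ s ∈ D.orientation N t, x ∈ s.right := by
  refine ⟨fun hx s ⟨_, e, he, ht⟩ => he.mem_right.2 ⟨t, ht, hx⟩, fun h => ?_⟩
  by_contra hx
  obtain ⟨u, hu⟩ : ∃ u, x ∈ D.part u := Set.mem_iUnion.1 (D.iUnion_part ▸ Set.mem_univ x)
  obtain ⟨p⟩ := D.isTree.connected.preconnected t u
  obtain ⟨v, w, hwv, hv, hw, ht⟩ := p.exists_adj_mem (X := {t | x ∈ D.part t}) hx hu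
  obtain ⟨s, hs, he⟩ := hD.1 ⟨(w, v), hwv⟩
  obtain ⟨y, hy, hxy⟩ := he.mem_right.1 (h s ⟨hs, _, he, ht⟩)
  obtain ⟨q, hq, -⟩ := D.isTree.existsUnique_path y w
  have := (q.mem_support_of_forall_adj (X := D.tree.ahead w v)
    (fun _ _ => SimpleGraph.eq_of_adj_of_mem_ahead) hy (D.isTree.notMem_ahead hwv)).2
  exact hv (D.inter_subset_of_mem_path y v w q hq this ⟨hxy, hw⟩)

/-- An edge separating two nodes is oriented differently by them; it can be recovered from its
separation by bijectivity. -/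
theorem IsInducing.orientation_injective (hD : D.IsInducing N) :
    Function.Injective (D.orientation N) := by
  intro t u htu
  by_contra hne
  obtain ⟨p⟩ := D.isTree.connected.preconnected t u
  obtain ⟨v, w, hwv, -, rfl, ht⟩ := p.exists_adj_mem (X := {u}) hne rfl
  obtain ⟨s, hs, he⟩ := hD.1 ⟨(w, v), hwv⟩
  obtain ⟨-, f, hf, hu⟩ := htu.subset ⟨hs, _, he, ht⟩
  rw [← hD.eq_dart he hf] at hu
  exact D.isTree.notMem_ahead hwv hu

theorem IsInducing.isFlip (hD : D.IsInducing N) (h : D.Induces e s) :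
    IsFlip s (D.orientation N e.snd) (D.orientation N e.fst) := by
  have key : ∀ {e : D.tree.Dart} {s : Separation G}, D.Induces e s →
      D.orientation N e.snd \ {s} ⊆ D.orientation N e.fst \ {s.inv} := by
    rintro e s h r ⟨⟨hr, f, hf, hef⟩, hrs⟩
    have hne : f ≠ e := by
      rintro rfl
      exact hrs (hf.eq h)
    have hfst : e.fst ∈ D.tree.ahead f.fst f.snd := by
      by_contra hc
      obtain ⟨h1, h2⟩ := SimpleGraph.eq_of_adj_of_mem_ahead e.adj hc hef
      exact hne (SimpleGraph.Dart.ext _ _ (Prod.ext h1.symm h2.symm))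
    refine ⟨⟨hr, f, hf, hfst⟩, ?_⟩
    rintro rfl
    rw [hD.eq_dart hf h.symm] at hef
    exact D.isTree.notMem_ahead e.adj.symm hef
  refine ⟨⟨hD.mem h, e, h, SimpleGraph.mem_ahead_self⟩,
    ⟨hD.mem h.symm, e.symm, h.symm, SimpleGraph.mem_ahead_self⟩, (key h).antisymm (key h.symm)⟩

/-- A tree-decomposition that induces the tree set `N` is, up to renaming the nodes, the one whose
nodes are the consistent orientations of `N`. -/
theorem IsInducing.isEquivalent [Finite V] (hD : D.IsInducing N) (hN : IsTreeSet N) :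
    D.IsEquivalent hN.treeDecomposition := by
  let f : D.Node → Orientations N := fun t =>
    ⟨D.orientation N t, isConsistentOrientation_orientation hN hD t⟩
  have hprin : ∀ e s, D.Induces e s → D.orientation N e.snd = principalOrientation N s :=
    fun e s h => (hD.isFlip h).eq_principal hN (f e.snd).2 (f e.fst).2
  have hadj : ∀ {t u}, (orientationGraph N).Adj (f t) (f u) ↔ D.tree.Adj t u := by
    intro t u
    constructor
    · rintro ⟨s, hs⟩
      have hsN := (f t).2.1 hs.1
      obtain ⟨e, he⟩ := (hD.2 s hsN).exists
      have h1 : t = e.snd := hD.orientation_injective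
        ((hs.eq_principal hN (f t).2 (f u).2).trans (hprin e s he).symm)
      have h2 : u = e.fst := hD.orientation_injective
        ((hs.symm.eq_principal hN (f u).2 (f t).2).trans (hprin e.symm s.inv he.symm).symm)
      rw [h1, h2]
      exact e.adj.symm
    · intro h
      obtain ⟨s, -, he⟩ := hD.1 ⟨(u, t), h.symm⟩
      exact ⟨s, hD.isFlip he⟩
  have hinj : Function.Injective f := fun t u h => hD.orientation_injective (congrArg Subtype.val h)
  have hsurj : Function.Surjective f := by
    intro B
    obtain ⟨t⟩ := D.isTree.connected.nonempty
    -- The range is closed under adjacency: the separation inverted along an edge at `f t` is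
    -- induced by a tree edge, whose other end yields the neighbour.
    refine (hN.reachable (f t) B).mem_iff_of_forall_adj (X := Set.range f) ?_ ⟨t, rfl⟩
    rintro x y ⟨s, hs⟩ -
    obtain ⟨e, he⟩ := (hD.2 s (x.2.1 hs.1)).exists
    exact ⟨e.fst, Subtype.ext ((hprin e.symm s.inv he.symm).trans
      (hs.symm.eq_principal hN y.2 x.2).symm)⟩
  refine ⟨⟨Equiv.ofBijective f ⟨hinj, hsurj⟩, hadj⟩, fun t => ?_⟩
  ext x
  exact hD.mem_part_iff.symm

end TreeDecomposition

/-! ### The orientation tree induces its tree set. -/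

section Existence

variable {V : Type u} [Finite V] {G : SimpleGraph V} {N : Set (Separation G)} {s : Separation G}

/-- The oriented edge of the decomposition tree that corresponds to `s`. -/
def IsTreeSet.dart (hN : IsTreeSet N) (hs : s ∈ N) : hN.treeDecomposition.tree.Dart :=
  ⟨(hN.principal (hN.inv_mem s hs), hN.principal hs), hN.adj_principal hs⟩

/-- A vertex of `s.right` lies in the part of some orientation that contains `s`, obtained by
pointing everything at that vertex; these orientations form one side of the edge by
`IsTreeSet.ahead_principal`. -/
theorem IsTreeSet.induces (hN : IsTreeSet N) (hs : s ∈ N) :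
    hN.treeDecomposition.Induces (hN.dart hs) s := by
  have key : ∀ s ∈ N, ∀ x, x ∈ s.right ↔ ∃ A ∈ {A : Orientations N | s ∈ A.1},
      x ∈ hN.treeDecomposition.part A := by
    refine fun s hs x => ⟨fun hx => ?_, fun ⟨A, hA, hx⟩ => hx s hA⟩
    obtain ⟨O, hO, h1, h2⟩ := hN.exists_orientation_of_mem (X := {x})
      (fun s _ => s.singleton_subset_or x) hs (Set.singleton_subset_iff.2 hx)
    exact ⟨⟨O, hO⟩, h1, fun t ht => h2 t ht rfl⟩
  refine TreeDecomposition.induces_iff.2 ⟨fun x => ?_, fun x => ?_⟩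
  · have := key s.inv (hN.inv_mem s hs) x
    rw [← hN.ahead_principal (hN.inv_mem s hs)] at this
    exact this
  · have := key s hs x
    rw [← hN.ahead_principal hs] at this
    exact this

theorem IsTreeSet.isInducing (hN : IsTreeSet N) : hN.treeDecomposition.IsInducing N := by
  have key : ∀ e : hN.treeDecomposition.tree.Dart, ∃ s, ∃ hs : s ∈ N,
      e = hN.dart hs := by
    rintro ⟨⟨A, B⟩, s, h⟩
    have hs := B.2.1 h.2.1
    refine ⟨s.inv, hs, SimpleGraph.Dart.ext _ _ (Prod.ext ?_ ?_)⟩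
    · exact Subtype.ext (h.eq_principal hN A.2 B.2)
    · exact Subtype.ext (h.symm.eq_principal hN B.2 A.2)
  refine ⟨fun e => ?_, fun s hs => ⟨_, hN.induces hs, fun e he => ?_⟩⟩
  · obtain ⟨s, hs, rfl⟩ := key e
    exact ⟨s, hs, hN.induces hs⟩
  · obtain ⟨s', hs', rfl⟩ := key e
    obtain rfl := he.eq (hN.induces hs')
    rfl

end Existence

/-! ### Transfer along graph isomorphisms. -/

namespace TreeDecomposition

variable {V W : Type u} {G : SimpleGraph V} {H : SimpleGraph W} {φ : G ≃g H}
  {D : TreeDecomposition G} {D' : TreeDecomposition H} {ψ ψ' : D.tree ≃g D'.tree}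

theorem mem_ahead_iff {α β : Type u} {T : SimpleGraph α} {T' : SimpleGraph β} (ψ : T ≃g T')
    {a b t : α} : ψ t ∈ T'.ahead (ψ a) (ψ b) ↔ t ∈ T.ahead a b := by
  have key : ∀ {α β : Type u} {T : SimpleGraph α} {T' : SimpleGraph β} (ψ : T ≃g T') {a b t : α},
      t ∈ T.ahead a b → ψ t ∈ T'.ahead (ψ a) (ψ b) := by
    intro α β T T' ψ a b t h
    refine SimpleGraph.Reachable.mem_iff_of_forall_adj (X := {t | ψ t ∈ T'.ahead (ψ a) (ψ b)}) h ?_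
      SimpleGraph.mem_ahead_self
    intro x y hxy hx
    refine SimpleGraph.Reachable.trans hx (SimpleGraph.Adj.reachable ?_)
    rw [SimpleGraph.deleteEdges_adj] at hxy ⊢
    refine ⟨ψ.map_adj_iff.2 hxy.1, fun he => hxy.2 ?_⟩
    rcases Sym2.eq_iff.1 he with ⟨h1, h2⟩ | ⟨h1, h2⟩
    · exact Sym2.eq_iff.2 (.inl ⟨ψ.injective h1, ψ.injective h2⟩)
    · exact Sym2.eq_iff.2 (.inr ⟨ψ.injective h1, ψ.injective h2⟩)
  refine ⟨fun h => ?_, key ψ⟩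
  simpa using key ψ.symm h

theorem IsCompatible.induces (h : IsCompatible φ D D' ψ) {e : D.tree.Dart} {s : Separation G}
    (hs : D.Induces e s) : D'.Induces (ψ.toHom.mapDart e) (s.map φ) := by
  have key : ∀ a b x, (∃ t ∈ D.tree.ahead a b, x ∈ D.part t) ↔
      ∃ t ∈ D'.tree.ahead (ψ a) (ψ b), φ x ∈ D'.part t := by
    intro a b x
    rw [ψ.surjective.exists]
    refine exists_congr fun t => and_congr (mem_ahead_iff ψ).symm ?_
    rw [h t, φ.injective.mem_set_image]
  refine induces_iff.2 ⟨fun y => ?_, fun y => ?_⟩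
  · obtain ⟨x, rfl⟩ := φ.surjective y
    exact (φ.injective.mem_set_image.trans hs.mem_left).trans (key _ _ x)
  · obtain ⟨x, rfl⟩ := φ.surjective y
    exact (φ.injective.mem_set_image.trans hs.mem_right).trans (key _ _ x)

theorem map_injective (φ : G ≃g H) : Function.Injective (Separation.map φ) := fun _ _ h =>
  Separation.ext (φ.injective.image_injective (congrArg Separation.left h))
    (φ.injective.image_injective (congrArg Separation.right h))

theorem IsCompatible.isInducing (h : IsCompatible φ D D' ψ) {N : Set (Separation G)}
    (hD : D.IsInducing N) : D'.IsInducing (Separation.map φ '' N) := by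
  have hsurj : ∀ e' : D'.tree.Dart, ∃ e : D.tree.Dart, ψ.toHom.mapDart e = e' := fun e' =>
    ⟨ψ.symm.toHom.mapDart e', SimpleGraph.Dart.ext _ _
      (Prod.ext (ψ.apply_symm_apply e'.fst) (ψ.apply_symm_apply e'.snd))⟩
  refine ⟨fun e' => ?_, ?_⟩
  · obtain ⟨e, rfl⟩ := hsurj e'
    obtain ⟨s, hs, he⟩ := hD.1 e
    exact ⟨_, ⟨s, hs, rfl⟩, h.induces he⟩
  · rintro _ ⟨s, hs, rfl⟩
    obtain ⟨e, he⟩ := (hD.2 s hs).exists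
    refine ⟨_, h.induces he, fun e' he' => ?_⟩
    obtain ⟨f, rfl⟩ := hsurj e'
    obtain ⟨r, hr, hf⟩ := hD.1 f
    obtain rfl := map_injective φ (he'.eq (h.induces hf))
    rw [hD.eq_dart hf he]

/-- Edges are determined by the separations they induce, so the image of every edge, and hence of
its ends, is forced. A node without neighbours is the whole tree. -/
theorem IsCompatible.unique (h : IsCompatible φ D D' ψ) (h' : IsCompatible φ D D' ψ')
    {N : Set (Separation G)} {N' : Set (Separation H)} (hD : D.IsInducing N)
    (hD' : D'.IsInducing N') : ψ = ψ' := by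
  ext t
  by_cases ht : ∃ u, D.tree.Adj t u
  · obtain ⟨u, hu⟩ := ht
    obtain ⟨s, -, he⟩ := hD.1 ⟨(t, u), hu⟩
    have := hD'.eq_dart (h.induces he) (h'.induces he)
    exact congrArg (fun e : D'.tree.Dart => e.fst) this
  · have hall : ∀ u, u = t := fun u =>
      (D.isTree.connected.preconnected t u).mem_iff_of_forall_adj (X := {t})
        (by rintro x y hxy rfl; exact absurd ⟨y, hxy⟩ ht) rfl
    rw [← ψ.apply_symm_apply (ψ' t), hall (ψ.symm (ψ' t))]

theorem IsEquivalent.symm {D D' : TreeDecomposition G} (h : D.IsEquivalent D') :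
    D'.IsEquivalent D := by
  obtain ⟨ψ, h⟩ := h
  exact ⟨ψ.symm, fun t => by rw [← h, ψ.apply_symm_apply]⟩

theorem IsEquivalent.trans {D D' D'' : TreeDecomposition G} (h : D.IsEquivalent D')
    (h' : D'.IsEquivalent D'') : D.IsEquivalent D'' := by
  obtain ⟨ψ, h⟩ := h
  obtain ⟨ψ', h'⟩ := h'
  exact ⟨ψ.trans ψ', fun t => (h' (ψ t)).trans (h t)⟩

theorem IsEquivalent.isInducing {D D' : TreeDecomposition G} (h : D.IsEquivalent D')
    {N : Set (Separation G)} (hD : D.IsInducing N) : D'.IsInducing N := by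
  obtain ⟨ψ, h⟩ := h
  have hc : IsCompatible (SimpleGraph.Iso.refl : G ≃g G) D D' ψ := fun t =>
    (h t).trans (Set.image_id _).symm
  have hid : Separation.map (SimpleGraph.Iso.refl : G ≃g G) = id := funext fun s =>
    Separation.ext (Set.image_id _) (Set.image_id _)
  have := hc.isInducing hD
  rwa [hid, Set.image_id] at this

/-- The image of a tree-decomposition under a graph isomorphism. -/
def transport (φ : G ≃g H) (D : TreeDecomposition G) : TreeDecomposition H where
  Node := D.Node
  finite_node := D.finite_node
  tree := D.tree
  isTree := D.isTree
  part t := φ '' D.part t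
  iUnion_part := by
    rw [← Set.image_iUnion, D.iUnion_part, Set.image_univ]
    exact φ.surjective.range_eq
  exists_part_of_adj x y hxy := by
    obtain ⟨t, h1, h2⟩ := D.exists_part_of_adj (φ.symm x) (φ.symm y) (φ.symm.map_adj_iff.2 hxy)
    exact ⟨t, ⟨_, h1, φ.apply_symm_apply x⟩, ⟨_, h2, φ.apply_symm_apply y⟩⟩
  inter_subset_of_mem_path t₁ t₂ t₃ p hp ht := by
    rw [← Set.image_inter φ.injective]
    exact Set.image_mono (D.inter_subset_of_mem_path t₁ t₂ t₃ p hp ht)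

/-- If `D` induces a tree set and `D'` induces its image under `φ`, then there is a unique
isomorphism of the decomposition trees compatible with `φ`. -/
theorem IsInducing.existsUnique_isCompatible [Finite W] {N : Set (Separation G)}
    (hD : D.IsInducing N) (hD' : D'.IsInducing (Separation.map φ '' N))
    (hN : IsTreeSet (Separation.map φ '' N)) : ∃! ψ, IsCompatible φ D D' ψ := by
  -- The transported decomposition and `D'` both induce the image of `N`, so both are equivalent to
  -- its orientation tree.
  have hc : IsCompatible φ D (D.transport φ) SimpleGraph.Iso.refl := fun t => rfl
  obtain ⟨ψ, hψ⟩ := ((hc.isInducing hD).isEquivalent hN).trans (hD'.isEquivalent hN).symm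
  have hψ' : IsCompatible φ D D' ψ := hψ
  exact ⟨ψ, hψ', fun χ hχ => IsCompatible.unique hχ hψ' hD hD'⟩

end TreeDecomposition

/-! ### The construction commutes with graph isomorphisms. -/

section Equivariance

open Separation TreeDecomposition

variable {V W : Type u} {G : SimpleGraph V} {H : SimpleGraph W} (φ : G ≃g H)
  {S N O P P' : Set (Separation G)} {𝓟 : Set (Set (Separation G))} {s t : Separation G}

namespace Separation

theorem map_surjective : Function.Surjective (Separation.map φ) := fun s =>
  ⟨s.map φ.symm, by
    have h : ∀ X : Set W, φ '' (φ.symm '' X) = X := fun X => by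
      rw [Set.image_image]
      simp
    exact Separation.ext (h _) (h _)⟩

theorem map_le_map : s.map φ ≤ t.map φ ↔ s ≤ t :=
  and_congr (Set.image_subset_image_iff φ.injective) (Set.image_subset_image_iff φ.injective)

theorem map_inv : s.inv.map φ = (s.map φ).inv := rfl

theorem order_map : (s.map φ).order = s.order := by
  change (φ '' s.left ∩ φ '' s.right).ncard = _
  rw [← Set.image_inter φ.injective, Set.ncard_image_of_injective _ φ.injective]
  rfl

theorem isProper_map : (s.map φ).IsProper ↔ s.IsProper :=
  and_congr (Set.image_subset_image_iff φ.injective).not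
    (Set.image_subset_image_iff φ.injective).not

theorem nested_map : (s.map φ).Nested (t.map φ) ↔ s.Nested t := by
  simp only [Nested, ← map_inv, map_le_map]

theorem mem_image_map : s.map φ ∈ Separation.map φ '' S ↔ s ∈ S :=
  (map_injective φ).mem_set_image

/-- As `Separation.map φ` is bijective, equivariance of a set reduces to a membership equivalence.
-/
theorem eq_image_map {A : Set (Separation H)} (h : ∀ s, s.map φ ∈ A ↔ s ∈ S) :
    A = Separation.map φ '' S := by
  ext x
  obtain ⟨s, rfl⟩ := map_surjective φ x
  rw [h, mem_image_map]

theorem corner_map : (s.map φ).corner (t.map φ) = (s.corner t).map φ :=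
  Separation.ext (Set.image_union _ _ _).symm (Set.image_inter φ.injective).symm

end Separation

theorem isConsistent_image : IsConsistent (Separation.map φ '' P) ↔ IsConsistent P := by
  simp only [IsConsistent, Set.forall_mem_image, (map_surjective φ).forall, map_le_map, ← map_inv,
    mem_image_map]

theorem splits_image : Splits (s.map φ) (Separation.map φ '' O) ↔ Splits s O := by
  simp only [Splits, ← map_inv, ← Set.image_singleton, ← Set.image_union, isConsistent_image]

theorem isConsistentOrientation_image :
    IsConsistentOrientation (Separation.map φ '' N) (Separation.map φ '' O) ↔
      IsConsistentOrientation N O := by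
  simp only [IsConsistentOrientation, isConsistent_image, Set.forall_mem_image, ← map_inv,
    mem_image_map, Set.image_subset_image_iff (map_injective φ)]

theorem splitting_image : splitting (Separation.map φ '' S) (Separation.map φ '' O) =
    Separation.map φ '' splitting S O :=
  eq_image_map φ fun _ => and_congr (mem_image_map φ) (splits_image φ)

theorem inducing_image :
    inducing (Set.image (Separation.map φ) '' 𝓟) (Separation.map φ '' N) (Separation.map φ '' O) =
      Set.image (Separation.map φ) '' inducing 𝓟 N O := by
  have key : ∀ P : Set (Separation G), Separation.map φ '' P ∩ Separation.map φ '' N =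
      Separation.map φ '' O ↔ P ∩ N = O := fun P => by
    rw [← Set.image_inter (map_injective φ), (map_injective φ).image_injective.eq_iff]
  ext Q
  constructor
  · rintro ⟨⟨P, hP, rfl⟩, h⟩
    exact ⟨P, ⟨hP, (key P).1 h⟩, rfl⟩
  · rintro ⟨P, ⟨hP, h⟩, rfl⟩
    exact ⟨⟨P, hP, rfl⟩, (key P).2 h⟩

theorem distinguishes_image : (s.map φ).Distinguishes (Separation.map φ '' P)
    (Separation.map φ '' P') ↔ s.Distinguishes P P' := by
  simp only [Distinguishes, Set.mem_sdiff, ← map_inv, mem_image_map]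

theorem reduction_image : reduction (Separation.map φ '' S) (Set.image (Separation.map φ) '' 𝓟) =
    Separation.map φ '' reduction S 𝓟 :=
  eq_image_map φ fun s => and_congr (mem_image_map φ) (by
    simp only [Set.exists_mem_image, distinguishes_image])

theorem isExtremal_image : IsExtremal (Separation.map φ '' S) (s.map φ) ↔ IsExtremal S s := by
  simp only [IsExtremal, Set.forall_mem_image, ← map_inv, mem_image_map, map_le_map]

theorem maximal_image : Maximal (· ∈ Separation.map φ '' S) (s.map φ) ↔ Maximal (· ∈ S) s := by
  simp only [Maximal, (map_surjective φ).forall, mem_image_map, map_le_map]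

theorem isWellSeparated_image :
    IsWellSeparated (Separation.map φ '' P) (Separation.map φ '' S) ↔ IsWellSeparated P S := by
  simp only [IsWellSeparated, IsNestedSet, (map_surjective φ).forall, Set.mem_ofPred_eq,
    ← Set.image_inter (map_injective φ), maximal_image, nested_map]

theorem isLocallyMaximal_image :
    IsLocallyMaximal (Separation.map φ '' S) (Set.image (Separation.map φ) '' 𝓟) (s.map φ) ↔
      IsLocallyMaximal S 𝓟 s := by
  simp only [IsLocallyMaximal, Set.exists_mem_image, isWellSeparated_image,
    ← Set.image_inter (map_injective φ), maximal_image]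

theorem extSet_image : extSet (Separation.map φ '' S) = Separation.map φ '' extSet S :=
  eq_image_map φ fun s => or_congr (isExtremal_image φ) (isExtremal_image φ (s := s.inv))

theorem locSet_image : locSet (Separation.map φ '' S) (Set.image (Separation.map φ) '' 𝓟) =
    Separation.map φ '' locSet S 𝓟 :=
  eq_image_map φ fun s => or_congr (isLocallyMaximal_image φ) (isLocallyMaximal_image φ (s := s.inv))

theorem allSet_image : allSet (Separation.map φ '' S) = Separation.map φ '' allSet S :=
  eq_image_map φ fun s => and_congr (mem_image_map φ) (by
    simp only [Set.forall_mem_image, nested_map])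

theorem Step.apply_image (a : Step) :
    a.apply (Separation.map φ '' S) (Set.image (Separation.map φ) '' 𝓟) =
      Separation.map φ '' a.apply S 𝓟 := by
  cases a <;> simp only [Step.apply, reduction_image, extSet_image, locSet_image, allSet_image]

theorem iUnion_orientations_image {D : Set (Separation H) → Set (Separation H)}
    {D' : Set (Separation G) → Set (Separation G)}
    (h : ∀ O, IsConsistentOrientation N O → D (Separation.map φ '' O) = Separation.map φ '' D' O) :
    Separation.map φ '' N ∪ ⋃ O ∈ {O | IsConsistentOrientation (Separation.map φ '' N) O}, D O =
      Separation.map φ '' (N ∪ ⋃ O ∈ {O | IsConsistentOrientation N O}, D' O) := by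
  refine eq_image_map φ fun s => or_congr (mem_image_map φ) ?_
  simp only [Set.mem_iUnion, Set.mem_ofPred_eq, exists_prop,
    (map_surjective φ).image_surjective.exists, isConsistentOrientation_image]
  exact exists_congr fun O => and_congr_right fun hO => by rw [h O hO, mem_image_map]

/-- The induction follows the recursion of `determined`, each of whose ingredients is equivariant.
-/
theorem determined_image [Finite V] [Finite W] {σ : Strategy} (hσ : ∀ n, (σ.step n).IsReducing) :
    determined σ (Separation.map φ '' S) (Set.image (Separation.map φ) '' 𝓟) =
      Separation.map φ '' determined σ S 𝓟 := by
  induction hn : S.ncard using Nat.strong_induction_on generalizing S 𝓟 σ with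
  | _ n ih =>
    subst hn
    by_cases hR : reduction S 𝓟 = S
    · have hR' : reduction (Separation.map φ '' S) (Set.image (Separation.map φ) '' 𝓟) =
          Separation.map φ '' S := by rw [reduction_image, hR]
      by_cases hN : ((σ.step 0).apply S 𝓟 ∩ S).Nonempty
      · rw [determined_of_reduction_eq (hσ 0) hR hN, determined_of_reduction_eq (hσ 0) hR',
          Step.apply_image, iUnion_orientations_image]
        · intro O hO
          rw [splitting_image, inducing_image]
          exact ih _ (splitting_ncard_lt hO hN) (fun n => hσ (n + 1)) rfl
        · rw [Step.apply_image, ← Set.image_inter (map_injective φ)]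
          exact hN.image _
      · rw [determined_of_not_nonempty (hσ 0) hR hN, determined_of_not_nonempty (hσ 0) hR',
          Set.image_empty]
        rwa [Step.apply_image, ← Set.image_inter (map_injective φ), Set.image_nonempty]
    · have hR' : reduction S 𝓟 ⊂ S := Set.ssubset_iff_subset_ne.2 ⟨reduction_subset, hR⟩
      rw [determined_of_reduction_ssubset (hσ 0) hR', determined_of_reduction_ssubset (hσ 0),
        reduction_image]
      · exact ih _ (separation_ncard_lt hR') hσ rfl
      · rw [reduction_image]
        exact (map_injective φ).image_strictMono hR'

theorem restrictOrder_image (ℓ : ℕ) :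
    restrictOrder ℓ (Separation.map φ '' P) = Separation.map φ '' restrictOrder ℓ P :=
  eq_image_map φ fun s => and_congr (mem_image_map φ) (by rw [order_map])

theorem kDetermined_image [Finite V] [Finite W] {k : ℕ} {σ : Fin k → Strategy}
    (hσ : ∀ i n, ((σ i).step n).IsReducing) :
    kDetermined H k σ (Set.image (Separation.map φ) '' 𝓟) =
      Separation.map φ '' kDetermined G k σ 𝓟 := by
  induction k generalizing 𝓟 with
  | zero => simp [kDetermined]
  | succ k ih =>
    cases k with
    | zero =>
      rw [kDetermined, kDetermined, ← determined_image φ (hσ 0)]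
      congr 1
      exact eq_image_map φ fun s => and_congr (isProper_map φ) (by rw [order_map])
    | succ k =>
      have h1 : restrictOrder (k + 1) '' (Set.image (Separation.map φ) '' 𝓟) =
          Set.image (Separation.map φ) '' (restrictOrder (k + 1) '' 𝓟) := by
        simp only [Set.image_image, restrictOrder_image]
      simp only [kDetermined]
      rw [h1, ih (σ := Fin.init σ) (fun i => hσ _), iUnion_orientations_image]
      intro O _
      rw [← determined_image φ (hσ _), ← inducing_image, ← splitting_image]
      congr 2
      refine eq_image_map φ fun s => and_congr (isProper_map φ) (and_congr (by rw [order_map]) ?_)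
      simp only [Set.forall_mem_image, nested_map]

theorem isKProfile_image {k : ℕ} :
    IsKProfile k (Separation.map φ '' P) ↔ IsKProfile k P := by
  simp only [IsKProfile, IsProfile, isConsistent_image, Set.forall_mem_image, corner_map, ← map_inv,
    mem_image_map, order_map, (map_surjective φ).forall]

end Equivariance

/-! ### Blocks and tangles as `k`-profiles. -/

section BlocksAndTangles

open Separation

variable {V : Type u} {G : SimpleGraph V} {k : ℕ} {b : Set V} {τ : Set (Separation G)}

theorem IsInseparable.not_subset_inter [Finite V] (hb : IsInseparable G k b) {s : Separation G}
    (hs : s.order < k) : ¬ b ⊆ s.left ∩ s.right := fun h =>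
  (hb.1.trans (Set.ncard_le_ncard h (Set.toFinite _))).not_gt hs

/-- Any violation would put `b`, which has at least `k` vertices, into a separator of size below
`k`. -/
theorem IsInseparable.isKProfile_blockProfile [Finite V] (hb : IsInseparable G k b) :
    IsKProfile k (blockProfile G k b) := by
  refine ⟨⟨fun s hs t hts ht => ?_, fun s hs t ht h => ?_⟩, fun s hs => hs.1, fun s hs => ?_⟩
  · exact hb.not_subset_inter ht.1 (Set.subset_inter (hs.2.trans hts.2) ht.2)
  · exact hb.not_subset_inter h.1 (Set.subset_inter (Set.subset_inter hs.2 ht.2) h.2)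
  · have h1 : s ∈ blockProfile G k b ↔ b ⊆ s.right := and_iff_right hs
    have h2 : s.inv ∈ blockProfile G k b ↔ b ⊆ s.left := and_iff_right ((order_inv s).trans_lt hs)
    rw [h1, h2]
    rcases hb.2 s hs with h | h
    · exact .inr ⟨h, fun h' => hb.not_subset_inter hs (Set.subset_inter h h')⟩
    · exact .inl ⟨h, fun h' => hb.not_subset_inter hs (Set.subset_inter h' h)⟩

theorem induce_sup_eq_top {A B C : Set V} (hV : ∀ x, x ∈ A ∨ x ∈ B ∨ x ∈ C)
    (hE : ∀ x y, G.Adj x y → {x, y} ⊆ A ∨ {x, y} ⊆ B ∨ {x, y} ⊆ C) :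
    (⊤ : G.Subgraph).induce A ⊔ (⊤ : G.Subgraph).induce B ⊔ (⊤ : G.Subgraph).induce C = ⊤ := by
  ext x y
  · simpa [or_assoc] using hV x
  · simp only [SimpleGraph.Subgraph.sup_adj, SimpleGraph.Subgraph.induce_adj,
      SimpleGraph.Subgraph.top_adj]
    constructor
    · rintro ((h | h) | h) <;> exact h.2.2
    · intro h
      have := hE x y h
      simp only [Set.insert_subset_iff, Set.singleton_subset_iff] at this
      tauto

/-- Violations yield forbidden triples: `s, t.inv, t.inv` for consistency, and `s`, `t` with the
inverse of their corner for the profile property. -/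
theorem IsTangle.isKProfile (hτ : IsTangle k τ) : IsKProfile k τ := by
  refine ⟨⟨fun s hs t hts ht => ?_, fun s hs t ht h => ?_⟩, hτ.1, hτ.2.1⟩
  · refine hτ.2.2 s hs t.inv ht t.inv ht (induce_sup_eq_top (fun x => ?_) fun x y hxy => ?_)
    · rcases t.singleton_subset_or x with h | h
      · exact .inl (hts.1 (h rfl))
      · exact .inr (.inl (h rfl))
    · rcases t.subset_or_of_adj hxy with h | h
      · exact .inl (h.trans hts.1)
      · exact .inr (.inl h)
  · refine hτ.2.2 s hs t ht _ h (induce_sup_eq_top (fun x => ?_) fun x y hxy => ?_)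
    · rcases s.singleton_subset_or x with h | h
      · exact .inl (h rfl)
      rcases t.singleton_subset_or x with h' | h'
      · exact .inr (.inl (h' rfl))
      · exact .inr (.inr ⟨h rfl, h' rfl⟩)
    · rcases s.subset_or_of_adj hxy with h | h
      · exact .inl h
      rcases t.subset_or_of_adj hxy with h' | h'
      · exact .inr (.inl h')
      · exact .inr (.inr (Set.subset_inter h h'))

theorem blocksAndTangles_subset_kProfiles [Finite V] : blocksAndTangles G k ⊆ kProfiles G k := by
  rintro _ (⟨b, hb, rfl⟩ | hτ)
  exacts [hb.prop.isKProfile_blockProfile, hτ.isKProfile]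

/-- If the profiles agree, `b ∪ b'` is inseparable, and maximality makes it equal to both blocks. -/
theorem blockProfile_injOn [Finite V] {b b' : Set V} (hb : IsBlock G k b) (hb' : IsBlock G k b')
    (h : blockProfile G k b = blockProfile G k b') : b = b' := by
  have key : IsInseparable G k (b ∪ b') := by
    refine ⟨hb.prop.1.trans (Set.ncard_le_ncard Set.subset_union_left (Set.toFinite _)),
      fun s hs => ?_⟩
    rcases hb.prop.2 s hs with h1 | h1
    · have : s.inv ∈ blockProfile G k b' := h ▸ ⟨(order_inv s).trans_lt hs, h1⟩
      exact .inl (Set.union_subset h1 this.2)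
    · have : s ∈ blockProfile G k b' := h ▸ ⟨hs, h1⟩
      exact .inr (Set.union_subset h1 this.2)
  exact (hb.eq_of_subset key Set.subset_union_left).trans
    (hb'.eq_of_subset key Set.subset_union_right).symm

theorem IsResolving.distinguishesBlocksAndTangles [Finite V] {N : Set (Separation G)}
    {𝓟 : Set (Set (Separation G))} (hN : IsResolving N 𝓟) (h𝓟 : blocksAndTangles G k ⊆ 𝓟) :
    DistinguishesBlocksAndTangles k N := by
  refine ⟨fun b b' hb hb' hne => ?_, fun P hP P' hP' hne => ?_⟩
  · obtain ⟨s, hs, h1, h2⟩ := hN.distinguished _ (h𝓟 (.inl ⟨b, hb, rfl⟩)) _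
      (h𝓟 (.inl ⟨b', hb', rfl⟩)) fun h => hne (blockProfile_injOn hb hb' h)
    exact ⟨s, hs, .inr ⟨h2.2, h1.2⟩, hb.prop.not_subset_inter h1.1, hb'.prop.not_subset_inter h1.1⟩
  · obtain ⟨s, hs, h1, h2⟩ := hN.distinguished P (h𝓟 hP) P' (h𝓟 hP') hne
    exact ⟨s, hs, (distinguishes_iff (blocksAndTangles_subset_kProfiles hP).consistent
      (blocksAndTangles_subset_kProfiles hP').consistent).2 (.inl ⟨h1, h2⟩)⟩

end BlocksAndTangles

/-! ### Assembly of the main theorem. -/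

section Main

open Separation

theorem isTreeSet_kDetermined {V : Type u} [Finite V] {G : SimpleGraph V} {k : ℕ} (hk : 1 ≤ k)
    (Λ : KStrategy k) {𝓟 : Set (Set (Separation G))} (h𝓟 : 𝓟 ⊆ kProfiles G k) :
    IsTreeSet (kDetermined G k Λ.strategy 𝓟) := by
  obtain ⟨hN, hNe⟩ := kDetermined_spec hk Λ.isReducing h𝓟
  refine ⟨fun s hs => ?_, hN.inv_mem, hN.nested⟩
  obtain ⟨Q, hQ, Q', hQ', h, h', -⟩ := hNe s hs
  exact isProper_of_mem (h𝓟 hQ).consistent (h𝓟 hQ').consistent h h'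

theorem isInvariantProfileChoice_kProfiles (k : ℕ) :
    IsInvariantProfileChoice.{u} k fun _ _ G => kProfiles G k := by
  refine ⟨fun V _ G => ⟨blocksAndTangles_subset_kProfiles, subset_rfl⟩, fun V W _ _ G H φ => ?_⟩
  ext Q
  obtain ⟨P, rfl⟩ := (map_surjective φ).image_surjective Q
  rw [(TreeDecomposition.map_injective φ).image_injective.mem_set_image]
  exact isKProfile_image φ

/-- Every `k`-strategy defines a canonical tree-decomposition. -/
theorem KStrategy.exists_defines {k : ℕ} (hk : 1 ≤ k) (Λ : KStrategy k)
    {𝓟 : (V : Type u) → [Finite V] → (G : SimpleGraph V) → Set (Set (Separation G))}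
    (h𝓟 : IsInvariantProfileChoice k 𝓟) :
    ∃ F : (V : Type u) → [Finite V] → (G : SimpleGraph V) → TreeDecomposition G,
      IsCanonical F ∧
      ∀ (V : Type u) [Finite V] (G : SimpleGraph V),
        (∀ D : TreeDecomposition G, Λ.Defines (𝓟 V G) D ↔ D.IsEquivalent (F V G)) ∧
        (F V G).AdhesionLT k ∧
        DistinguishesBlocksAndTangles k (F V G).inducedSet := by
  have hT : ∀ (V : Type u) [Finite V] (G : SimpleGraph V),
      IsTreeSet (kDetermined G k Λ.strategy (𝓟 V G)) := fun V _ G =>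
    isTreeSet_kDetermined hk Λ (h𝓟.1 V G).2
  refine ⟨fun V _ G => (hT V G).treeDecomposition, fun V W _ _ G H φ => ?_, fun V _ G => ?_⟩
  · have himage := kDetermined_image φ (𝓟 := 𝓟 V G) Λ.isReducing
    rw [← h𝓟.2 V W G H φ] at himage
    refine (hT V G).isInducing.existsUnique_isCompatible (himage ▸ (hT W H).isInducing)
      (himage ▸ hT W H)
  · obtain ⟨hN, hNe⟩ := kDetermined_spec hk Λ.isReducing (h𝓟.1 V G).2
    refine ⟨fun D => ⟨fun h => h.isEquivalent (hT V G), fun h =>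
      h.symm.isInducing (hT V G).isInducing⟩, (hT V G).isInducing.adhesionLT fun s hs => ?_, ?_⟩
    · obtain ⟨Q, hQ, -, -, h, -⟩ := hNe s hs
      exact ((h𝓟.1 V G).2 hQ).2.1 s h
    · rw [(hT V G).isInducing.inducedSet_eq]
      exact hN.distinguishesBlocksAndTangles (h𝓟.1 V G).1

end Main

theorem theorem4p5 (k : ℕ) (hk : 1 ≤ k) :
    (∀ (Λ : KStrategy k)
      (𝓟 : (V : Type u) → [Finite V] → (G : SimpleGraph V) → Set (Set (Separation G))),
      IsInvariantProfileChoice k 𝓟 →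
      ∃ F : (V : Type u) → [Finite V] → (G : SimpleGraph V) → TreeDecomposition G,
        IsCanonical F ∧
        ∀ (V : Type u) [Finite V] (G : SimpleGraph V),
          (∀ D : TreeDecomposition G, Λ.Defines (𝓟 V G) D ↔ D.IsEquivalent (F V G)) ∧
          (F V G).AdhesionLT k ∧
          DistinguishesBlocksAndTangles k (F V G).inducedSet) ∧
    ∃ F : (V : Type u) → [Finite V] → (G : SimpleGraph V) → TreeDecomposition G,
      IsCanonical F ∧
      ∀ (V : Type u) [Finite V] (G : SimpleGraph V),
        (F V G).AdhesionLT k ∧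
        DistinguishesBlocksAndTangles k (F V G).inducedSet := by
  refine ⟨fun Λ 𝓟 h𝓟 => Λ.exists_defines hk h𝓟, ?_⟩
  -- Any `k`-strategy would do; a constant one is taken, with all `k`-profiles as the invariant
  -- choice.
  let Λ : KStrategy k :=
    { strategy := fun _ => ⟨fun _ => .extR, fun m => ⟨m, le_rfl, trivial⟩⟩
      isReducing := fun _ _ => trivial }
  obtain ⟨F, hF, h⟩ := Λ.exists_defines hk (isInvariantProfileChoice_kProfiles k)
  exact ⟨F, hF, fun V _ G => (h V G).2⟩
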